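/- **Curvature of random submaps.** *Maps.* A map $M=(G,\sigma)$ is a connected, locally finite multigraph $G$ (self-loops and multiple edges allowed) together with, for every vertex $v$, a cyclic permutation $\sigma_v$ (counterclockwise rotation) of the finite set of oriented edges emanating from $v$; write $\sigma$ for the resulting permutation of the set $E^{\to}$ of oriented edges, and $e^-$ for the tail, $-e$ for the reversal of an oriented edge $e$. The faces of $M$ are the orbits of $\sigma^\dagger(e)=\sigma^{-1}(-e)$ on $E^{\to}$; the orbit of $e$ is the face to the left of $e$, and the degree of a face is the cardinality of the orbit (possibly $\infty$). Gluing, along the edges of $G$, a closed disc with $d$ boundary arcs for every face of finite degree $d$ and a closed half-plane with boundary arcs $[n,n+1]$, $n\in\mathbb Z$, for every face of infinite degree, gives an oriented surface $S(M)$ in which $G$ is embedded. *Submaps.* Let $H$ be a connected subgraph of $G$, with the cyclic orders induced by $\sigma$. Then $H$ is a submap of $M$ if the restriction to $H$ of the embedding of $G$ in $S(M)$ is proper: every compact set meets only finitely many edges of $H$; every connected component $C$ of the complement of the image of $H$ in $S(M)$ is homeomorphic to an open disc; and for every such $C$ the permutation that sends an oriented edge of $H$ with left-hand side incident to $C$ to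 the next oriented edge of $H$ around $C$ has exactly one orbit. Such an $H$ is again a map. *Unimodularity.* The space of isomorphism classes of rooted maps $(M,\rho)$ (likewise of doubly-rooted maps and of maps with $\{0,1\}$-marks on vertices and edges) carries the local topology, in which two objects are close if large balls around their (first) roots are isomorphic as (marked, doubly-) rooted maps, and its Borel $\sigma$-algebra. A random rooted (marked) map $(M,\rho)$ is unimodular if for every Borel function $f\ge 0$ of doubly-rooted (marked) maps, with values in $[0,\infty]$, $$\mathbb E\Big[\sum_{v}f(M,\rho,v)\Big]=\mathbb E\Big[\sum_{u}f(M,u,\rho)\Big],$$ the sums being over the vertices of $M$. A percolation on $(M,\rho)$ is a random $\{0,1\}$-marking $\omega$ of the vertices and edges of $M$ (possibly defined on a larger probability space) such that $(M,\rho,\omega)$ is unimodular; the marks $1$ and $0$ mean open and closed, and open edges have open endpoints. It is a bond percolation if almost surely all vertices are open, and it is connected if almost surely all open vertices lie in one connected component of the subgraph of open vertices and edges. *Curvature.* The average curvature of a unimodular random rooted map is $$\mathbb K(M,\rho)=\mathbb E[\kappa_M(\rho)],\qquad \kappa_M(v)=2\pi-\sum_{e:\,e^-=v}\frac{\deg(f_e)-2}{\deg(f_e)}\,\pi,$$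 where $f_e$ is the face to the left of $e$ and $(\infty-2)/\infty:=1$. *Statement.* Let $(M,\rho)$ be a unimodular random rooted map with $\mathbb E[\deg(\rho)]<\infty$, and let $\omega$ be a connected bond percolation on $(M,\rho)$ that is almost surely a submap of $M$. Then $\kappa_M(\rho)$ and $\kappa_\omega(\rho)$ are integrable and $$\mathbb K(\omega,\rho)=\mathbb K(M,\rho).$$ -/

import Mathlib

open MeasureTheory Set
open scoped ENNReal

noncomputable section

namespace RandomMap

/-! ### Maps -/

/-- A (locally finite, connected) map with marks in `X`, in its combinatorial form `(G, σ)`: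
`V` is the set of vertices and `D` the set of oriented edges of a connected, locally finite
multigraph `G` (self-loops and multiple edges allowed), `tail e = e⁻`, `rev e = -e`
(so that `e⁺ = tail (rev e)`), and `σ` restricts at every vertex `v` to a cyclic permutation of the
oriented edges emanating from `v` (counterclockwise rotation).
`vmark` and `emark` are the marks of the vertices and of the (unoriented) edges. -/
structure MarkedMap (X : Type) where
  V : Type
  D : Type
  tail : D → V
  rev : D → D
  rev_rev : ∀ e, rev (rev e) = e
  rev_ne : ∀ e, rev e ≠ e
  finite_star : ∀ v, {e | tail e = v}.Finite
  σ : Equiv.Perm D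
  cyclic : ∀ v, σ.IsCycleOn {e | tail e = v}
  nonempty : Nonempty V
  connected : ∀ u v, Relation.ReflTransGen (fun a b => ∃ e, tail e = a ∧ tail (rev e) = b) u v
  vmark : V → X
  emark : D → X
  emark_rev : ∀ e, emark (rev e) = emark e

namespace MarkedMap

variable {X : Type}

/-- The map without its marks. -/
def forget (M : MarkedMap X) : MarkedMap Unit :=
  { M with vmark := fun _ => (), emark := fun _ => (), emark_rev := fun _ => rfl }

/-- The degree of a vertex: the number of oriented edges emanating from it. -/
def degree (M : MarkedMap X) (v : M.V) : ℕ := {e | M.tail e = v}.ncard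

/-- Reversal of oriented edges, as a permutation. -/
def revPerm (M : MarkedMap X) : Equiv.Perm M.D := ⟨M.rev, M.rev, M.rev_rev, M.rev_rev⟩

/-- The permutation `σ†(e) = σ⁻¹(-e)`: the oriented edge that follows `e` around the face to the
left of `e`. -/
def dualPerm (M : MarkedMap X) : Equiv.Perm M.D := M.revPerm.trans M.σ.symm

/-- The face to the left of `e`: the orbit of `e` under `σ†`. -/
def face (M : MarkedMap X) (e : M.D) : Set M.D := {e' | M.dualPerm.SameCycle e e'}

open Classical in
/-- The internal angle `(d - 2) / d * π` of a regular `d`-gon, where `d` is the degree of the face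
to the left of `e`; it is `π` if that face has infinite degree. -/
def cornerAngle (M : MarkedMap X) (e : M.D) : ℝ :=
  if (M.face e).Finite then (((M.face e).ncard : ℝ) - 2) / ((M.face e).ncard : ℝ) * Real.pi
  else Real.pi

/-- The angle sum `θ(v)`: every face incident to `v` is counted once for every oriented edge that
emanates from `v` and has the face on its left. -/
def angleSum (M : MarkedMap X) (v : M.V) : ℝ := ∑ᶠ e ∈ {e | M.tail e = v}, M.cornerAngle e

/-- The curvature `κ(v) = 2π - θ(v)`. -/
def curvature (M : MarkedMap X) (v : M.V) : ℝ := 2 * Real.pi - M.angleSum v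

/-! ### Subgraphs and the map structure they inherit -/

lemma tail_σ (M : MarkedMap X) (e : M.D) : M.tail (M.σ e) = M.tail e :=
  (M.cyclic (M.tail e)).1.mapsTo rfl

lemma exists_pow (M : MarkedMap X) {e e' : M.D} (h : M.tail e = M.tail e') :
    ∃ n : ℕ, (M.σ ^ n) e = e' := by
  have hf := M.finite_star (M.tail e)
  have hc := M.cyclic (M.tail e)
  have key : M.σ.IsCycleOn (hf.toFinset : Set M.D) := by simpa using hc
  obtain ⟨n, -, hn⟩ := key.exists_pow_eq (a := e) (b := e') (by simp) (by simp [h])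
  exact ⟨n, hn⟩

lemma exists_return (M : MarkedMap X) (F : Set M.D) (e : F) :
    ∃ n : ℕ, (M.σ ^ (n + 1)) e.1 ∈ F := by
  obtain ⟨n, hn⟩ := M.exists_pow (M.tail_σ e.1)
  exact ⟨n, by rw [pow_succ, Equiv.Perm.mul_apply, hn]; exact e.2⟩

open Classical in
/-- The next element of `F` after `e` in the order given by `σ`. -/
def nextIn (M : MarkedMap X) (F : Set M.D) (e : F) : F :=
  ⟨(M.σ ^ (Nat.find (M.exists_return F e) + 1)) e.1, Nat.find_spec (M.exists_return F e)⟩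

lemma tail_nextIn (M : MarkedMap X) (F : Set M.D) (e : F) :
    M.tail (M.nextIn F e).1 = M.tail e.1 := by
  have : ∀ (n : ℕ) (d : M.D), M.tail ((M.σ ^ n) d) = M.tail d := by
    intro n
    induction n with
    | zero => intro d; simp
    | succ k ih => intro d; rw [pow_succ, Equiv.Perm.mul_apply, ih, M.tail_σ]
  exact this _ _

lemma exists_iterate_nextIn (M : MarkedMap X) (F : Set M.D) :
    ∀ (n : ℕ) (e e' : F), (M.σ ^ n) e.1 = e'.1 → ∃ k : ℕ, (M.nextIn F)^[k] e = e' := by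
  classical
  intro n
  induction n using Nat.strong_induction_on with
  | _ n ih =>
    intro e e' h
    rcases n with _ | n
    · exact ⟨0, Subtype.ext (by simpa using h)⟩
    · have hle : Nat.find (M.exists_return F e) ≤ n := Nat.find_min' _ (by rw [h]; exact e'.2)
      obtain ⟨k, hk⟩ := ih (n - Nat.find (M.exists_return F e)) (by omega) (M.nextIn F e) e' (by
        rw [← h, nextIn, ← Equiv.Perm.mul_apply, ← pow_add]
        congr 2
        omega)
      exact ⟨k + 1, by rw [Function.iterate_succ_apply]; exact hk⟩

lemma nextIn_bijective (M : MarkedMap X) (F : Set M.D) : Function.Bijective (M.nextIn F) := by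
  classical
  constructor
  · have aux : ∀ a b : F, M.nextIn F a = M.nextIn F b →
        Nat.find (M.exists_return F a) ≤ Nat.find (M.exists_return F b) → a = b := by
      intro a b h hle
      have h1 : (M.σ ^ (Nat.find (M.exists_return F a) + 1)) a.1 =
          (M.σ ^ (Nat.find (M.exists_return F b) + 1)) b.1 := congrArg Subtype.val h
      obtain ⟨d, hd⟩ := Nat.exists_eq_add_of_le hle
      rw [hd, show Nat.find (M.exists_return F a) + d + 1 =
        (Nat.find (M.exists_return F a) + 1) + d by omega,
        pow_add (M.σ) (Nat.find (M.exists_return F a) + 1) d, Equiv.Perm.mul_apply] at h1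
      have h2 : a.1 = (M.σ ^ d) b.1 := (M.σ ^ (Nat.find (M.exists_return F a) + 1)).injective h1
      rcases d with _ | d
      · exact Subtype.ext (by simpa using h2)
      · exact absurd (h2 ▸ a.2) (Nat.find_min (M.exists_return F b) (by omega))
    intro a b h
    rcases le_total (Nat.find (M.exists_return F a)) (Nat.find (M.exists_return F b)) with hl | hl
    · exact aux a b h hl
    · exact (aux b a h.symm hl).symm
  · intro b
    obtain ⟨n, hn⟩ := M.exists_pow (M.tail_nextIn F b)
    obtain ⟨k, hk⟩ := M.exists_iterate_nextIn F n _ b hn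
    refine ⟨(M.nextIn F)^[k] b, ?_⟩
    rw [← Function.iterate_succ_apply' (M.nextIn F) k b, Function.iterate_succ_apply]
    exact hk

/-- The cyclic orders induced by `σ` on a set `F` of oriented edges. -/
def inducedσ (M : MarkedMap X) (F : Set M.D) : Equiv.Perm F :=
  Equiv.ofBijective (M.nextIn F) (M.nextIn_bijective F)

/-- A connected subgraph of the underlying graph of `M`. -/
structure Sub (M : MarkedMap X) where
  verts : Set M.V
  darts : Set M.D
  tail_mem : ∀ e ∈ darts, M.tail e ∈ verts
  rev_mem : ∀ e ∈ darts, M.rev e ∈ darts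
  nonempty : verts.Nonempty
  connected : ∀ u ∈ verts, ∀ v ∈ verts,
    Relation.ReflTransGen (fun a b => ∃ e ∈ darts, M.tail e = a ∧ M.tail (M.rev e) = b) u v

/-- A connected subgraph with the cyclic orders and the marks inherited from `M`. -/
def Sub.toMap {M : MarkedMap X} (H : M.Sub) : MarkedMap X where
  V := H.verts
  D := H.darts
  tail e := ⟨M.tail e.1, H.tail_mem e.1 e.2⟩
  rev e := ⟨M.rev e.1, H.rev_mem e.1 e.2⟩
  rev_rev e := Subtype.ext (M.rev_rev e.1)
  rev_ne e h := M.rev_ne e.1 (congrArg Subtype.val h)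
  finite_star v := by
    refine ((M.finite_star v.1).preimage (f := Subtype.val)
      Subtype.val_injective.injOn).subset fun e he => ?_
    exact congrArg Subtype.val he
  σ := M.inducedσ H.darts
  cyclic v := by
    have ht : ∀ e : H.darts, M.tail (M.inducedσ H.darts e).1 = M.tail e.1 :=
      M.tail_nextIn H.darts
    constructor
    · refine (M.inducedσ H.darts).bijOn fun e => ?_
      simp only [mem_ofPred_eq, Subtype.ext_iff, ht]
    · intro e he e' he'
      have h1 : M.tail e.1 = M.tail e'.1 :=
        (congrArg Subtype.val he).trans (congrArg Subtype.val he').symm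
      obtain ⟨n, hn⟩ := M.exists_pow h1
      obtain ⟨k, hk⟩ := M.exists_iterate_nextIn H.darts n e e' hn
      refine ⟨k, ?_⟩
      rw [zpow_natCast, Equiv.Perm.coe_pow]
      exact hk
  nonempty := H.nonempty.to_subtype
  connected u v := by
    obtain ⟨u, hu⟩ := u
    obtain ⟨v, hv⟩ := v
    have h := H.connected u hu v hv
    induction h with
    | refl => exact .refl
    | tail _ hbc ih =>
      obtain ⟨e, he, hb, hc⟩ := hbc
      exact (ih (hb ▸ H.tail_mem e he)).tail ⟨⟨e, he⟩, Subtype.ext hb, Subtype.ext hc⟩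
  vmark v := M.vmark v.1
  emark e := M.emark e.1
  emark_rev e := M.emark_rev e.1

/-- Connectedness follows once every vertex can be reached from a fixed one. -/
lemma connected_of_base (M : MarkedMap X) (F : Set M.D) (hF : ∀ e ∈ F, M.rev e ∈ F) (U : Set M.V)
    (o : M.V) (h : ∀ v ∈ U,
      Relation.ReflTransGen (fun a b => ∃ e ∈ F, M.tail e = a ∧ M.tail (M.rev e) = b) o v) :
    ∀ u ∈ U, ∀ v ∈ U,
      Relation.ReflTransGen (fun a b => ∃ e ∈ F, M.tail e = a ∧ M.tail (M.rev e) = b) u v := by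
  intro u hu v hv
  refine Relation.ReflTransGen.trans ?_ (h v hv)
  have h1 := h u hu
  clear hu
  induction h1 with
  | refl => exact .refl
  | tail _ hbc ih =>
    obtain ⟨e, he, ha, hb⟩ := hbc
    exact .head ⟨M.rev e, hF e he, hb, by rw [M.rev_rev]; exact ha⟩ ih

/-- The set of vertices at graph distance at most `R` from `v`. -/
def ballVerts (M : MarkedMap X) (v : M.V) : ℕ → Set M.V
  | 0 => {v}
  | R + 1 => ballVerts M v R ∪ {u | ∃ e, M.tail e ∈ ballVerts M v R ∧ M.tail (M.rev e) = u}

lemma mem_ballVerts_self (M : MarkedMap X) (v : M.V) (R : ℕ) : v ∈ M.ballVerts v R := by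
  induction R with
  | zero => exact rfl
  | succ k ih => exact Or.inl ih

/-- The ball of radius `R` around `v`: the subgraph spanned by the vertices at distance at most
`R`. -/
def ball (M : MarkedMap X) (v : M.V) (R : ℕ) : M.Sub where
  verts := M.ballVerts v R
  darts := {e | M.tail e ∈ M.ballVerts v R ∧ M.tail (M.rev e) ∈ M.ballVerts v R}
  tail_mem _ he := he.1
  rev_mem e he := ⟨he.2, by rw [M.rev_rev]; exact he.1⟩
  nonempty := ⟨v, M.mem_ballVerts_self v R⟩
  connected := by
    refine M.connected_of_base
      {e | M.tail e ∈ M.ballVerts v R ∧ M.tail (M.rev e) ∈ M.ballVerts v R}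
      (fun e he => ⟨he.2, by rw [M.rev_rev]; exact he.1⟩) _ v ?_
    induction R with
    | zero => rintro u rfl; exact .refl
    | succ k ih =>
      have mono : ∀ u ∈ M.ballVerts v k, Relation.ReflTransGen (fun a b =>
          ∃ e ∈ {e | M.tail e ∈ M.ballVerts v (k + 1) ∧ M.tail (M.rev e) ∈ M.ballVerts v (k + 1)},
            M.tail e = a ∧ M.tail (M.rev e) = b) v u := by
        intro u hu
        refine Relation.ReflTransGen.mono ?_ _ _ (ih u hu)
        rintro a b ⟨e, he, hab⟩
        exact ⟨e, ⟨Or.inl he.1, Or.inl he.2⟩, hab⟩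
      rintro u (hu | ⟨e, he, rfl⟩)
      · exact mono u hu
      · exact (mono _ he).tail ⟨e, ⟨Or.inl he, Or.inr ⟨e, he, rfl⟩⟩, rfl, rfl⟩

/-! ### The surface of a map, and submaps -/

/-- The piece of the face to the left of `e` that lies along `e`: the part `t = 0` of the unit
square is the edge `e`, run through from its tail to its head. The part `t = 1`, which is going to
be the centre of the face, is present only if the face has finite degree. -/
def panel (M : MarkedMap X) (e : M.D) : Set (ℝ × ℝ) :=
  {p | 0 ≤ p.1 ∧ p.1 ≤ 1 ∧ 0 ≤ p.2 ∧ p.2 ≤ 1 ∧ (p.2 = 1 → (M.face e).Finite)}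

/-- The identifications between the panels. `side` and `apex` glue the panels of one face to
a closed disc with `d` boundary arcs if the face has finite degree `d`, and to the half-plane
`ℝ × [0, 1)` with boundary arcs `[n, n + 1]` if it has infinite degree; `edge` glues these faces
along the edges of the map. -/
inductive Glue (M : MarkedMap X) : (Σ e : M.D, M.panel e) → (Σ e : M.D, M.panel e) → Prop
  | side (e : M.D) (t : ℝ) (h : (1, t) ∈ M.panel e) (h' : (0, t) ∈ M.panel (M.dualPerm e)) :
      Glue M ⟨e, ⟨(1, t), h⟩⟩ ⟨M.dualPerm e, ⟨(0, t), h'⟩⟩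
  | edge (e : M.D) (x : ℝ) (h : (x, 0) ∈ M.panel e) (h' : (1 - x, 0) ∈ M.panel (M.rev e)) :
      Glue M ⟨e, ⟨(x, 0), h⟩⟩ ⟨M.rev e, ⟨(1 - x, 0), h'⟩⟩
  | apex (e e' : M.D) (x x' : ℝ) (he : e' ∈ M.face e) (h : (x, 1) ∈ M.panel e)
      (h' : (x', 1) ∈ M.panel e') :
      Glue M ⟨e, ⟨(x, 1), h⟩⟩ ⟨e', ⟨(x', 1), h'⟩⟩

/-- The surface `S(M)`, with the quotient topology. (It is empty for the map with one vertex and no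
edge, which has no oriented edges.) -/
def Surface (M : MarkedMap X) : Type := Quot M.Glue

instance (M : MarkedMap X) : TopologicalSpace M.Surface :=
  inferInstanceAs (TopologicalSpace (Quot M.Glue))

/-- The point of `S(M)` with coordinates `(x, t)` in the panel of `e`. -/
def point (M : MarkedMap X) (e : M.D) (p : M.panel e) : M.Surface := Quot.mk _ ⟨e, p⟩

/-- The closed arc of `S(M)` that represents the edge `e`. -/
def edgeArc (M : MarkedMap X) (e : M.D) : Set M.Surface :=
  {q | ∃ p : M.panel e, p.1.2 = 0 ∧ q = M.point e p}

/-- The point of `S(M)` at the tail of `e`. -/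
def tailPoint (M : MarkedMap X) (e : M.D) : M.Surface :=
  M.point e ⟨(0, 0), by simp [panel]⟩

/-- A point of `S(M)` in the face of `M` to the left of `e`. -/
def leftPoint (M : MarkedMap X) (e : M.D) : M.Surface :=
  M.point e ⟨(1 / 2, 1 / 2), by constructor <;> norm_num⟩

/-- The image of a subgraph in `S(M)`. -/
def Sub.image {M : MarkedMap X} (H : M.Sub) : Set M.Surface :=
  (⋃ e ∈ H.darts, M.edgeArc e) ∪ {q | ∃ e, M.tail e ∈ H.verts ∧ q = M.tailPoint e}

/-- The faces of the embedded subgraph: the connected components of the complement of its image. -/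
def Sub.faces {M : MarkedMap X} (H : M.Sub) : Set (Set M.Surface) :=
  {C | ∃ q ∈ H.imageᶜ, C = connectedComponentIn H.imageᶜ q}

/-- A connected subgraph `H` of `M` is a submap if the restriction to `H` of the embedding of `M`
into `S(M)` is proper: it is locally finite, every face is homeomorphic to the open disc,
and for every face `C`, the permutation that sends an oriented edge of `H` with left-hand side
incident to `C` to the next one around `C` has exactly one orbit. -/
structure Sub.IsSubmap {M : MarkedMap X} (H : M.Sub) : Prop where
  locallyFinite : ∀ K : Set M.Surface, IsCompact K →
    {e | e ∈ H.darts ∧ (M.edgeArc e ∩ K).Nonempty}.Finite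
  disc : ∀ C ∈ H.faces, Nonempty (C ≃ₜ Metric.ball (0 : ℂ) 1)
  single_orbit : ∀ C ∈ H.faces, ∃ e₀ : H.toMap.D,
    {e : H.toMap.D | M.leftPoint e.1 ∈ C} = H.toMap.face e₀

/-! ### Isomorphisms -/

/-- An isomorphism of marked maps. -/
structure Iso (M N : MarkedMap X) where
  v : M.V ≃ N.V
  d : M.D ≃ N.D
  tail : ∀ e, N.tail (d e) = v (M.tail e)
  rev : ∀ e, N.rev (d e) = d (M.rev e)
  σ : ∀ e, N.σ (d e) = d (M.σ e)
  vmark : ∀ u, N.vmark (v u) = M.vmark u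
  emark : ∀ e, N.emark (d e) = M.emark e

def Iso.refl (M : MarkedMap X) : Iso M M :=
  ⟨.refl _, .refl _, fun _ => rfl, fun _ => rfl, fun _ => rfl, fun _ => rfl, fun _ => rfl⟩

def Iso.symm {M N : MarkedMap X} (φ : Iso M N) : Iso N M where
  v := φ.v.symm
  d := φ.d.symm
  tail e := by rw [Equiv.eq_symm_apply, ← φ.tail, Equiv.apply_symm_apply]
  rev e := by rw [Equiv.eq_symm_apply, ← φ.rev, Equiv.apply_symm_apply]
  σ e := by rw [Equiv.eq_symm_apply, ← φ.σ, Equiv.apply_symm_apply]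
  vmark u := by rw [← φ.vmark, Equiv.apply_symm_apply]
  emark e := by rw [← φ.emark, Equiv.apply_symm_apply]

def Iso.trans {M N P : MarkedMap X} (φ : Iso M N) (ψ : Iso N P) : Iso M P where
  v := φ.v.trans ψ.v
  d := φ.d.trans ψ.d
  tail e := by simp [ψ.tail, φ.tail]
  rev e := by simp [ψ.rev, φ.rev]
  σ e := by simp [ψ.σ, φ.σ]
  vmark u := by simp [ψ.vmark, φ.vmark]
  emark e := by simp [ψ.emark, φ.emark]

end MarkedMap

/-! ### The spaces of rooted and doubly-rooted maps -/

/-- A marked map with a root vertex. -/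
structure Rooted (X : Type) where
  map : MarkedMap X
  root : map.V

/-- A marked map with an ordered pair of (not necessarily distinct) root vertices. -/
structure DoublyRooted (X : Type) where
  map : MarkedMap X
  fst : map.V
  snd : map.V

variable {X : Type}

instance Rooted.setoid (X : Type) : Setoid (Rooted X) where
  r x y := ∃ φ : MarkedMap.Iso x.map y.map, φ.v x.root = y.root
  iseqv :=
    { refl := fun x => ⟨.refl _, rfl⟩
      symm := fun ⟨φ, h⟩ => ⟨φ.symm, by simp [MarkedMap.Iso.symm, ← h]⟩
      trans := fun ⟨φ, h⟩ ⟨ψ, h'⟩ => ⟨φ.trans ψ, by simp [MarkedMap.Iso.trans, h, h']⟩ }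

instance DoublyRooted.setoid (X : Type) : Setoid (DoublyRooted X) where
  r x y := ∃ φ : MarkedMap.Iso x.map y.map, φ.v x.fst = y.fst ∧ φ.v x.snd = y.snd
  iseqv :=
    { refl := fun x => ⟨.refl _, rfl, rfl⟩
      symm := fun ⟨φ, h, k⟩ => ⟨φ.symm, by simp [MarkedMap.Iso.symm, ← h, ← k]⟩
      trans := fun ⟨φ, h, k⟩ ⟨ψ, h', k'⟩ =>
        ⟨φ.trans ψ, by simp [MarkedMap.Iso.trans, h, h', k, k']⟩ }

/-- The space of isomorphism classes of rooted maps with marks in `X`. -/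
def RootedClass (X : Type) : Type 1 := Quotient (Rooted.setoid X)

/-- The space of isomorphism classes of doubly-rooted maps with marks in `X`. -/
def DoublyRootedClass (X : Type) : Type 1 := Quotient (DoublyRooted.setoid X)

/-- The isomorphism class of a rooted map. -/
def Rooted.cls (x : Rooted X) : RootedClass X := Quotient.mk _ x

/-- The isomorphism class of a doubly-rooted map. -/
def DoublyRooted.cls (x : DoublyRooted X) : DoublyRootedClass X := Quotient.mk _ x

/-- The balls of radius `R` around the roots are isomorphic as rooted marked maps. -/
def Rooted.Agree (R : ℕ) (x y : Rooted X) : Prop :=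
  ∃ φ : MarkedMap.Iso (x.map.ball x.root R).toMap (y.map.ball y.root R).toMap,
    (φ.v ⟨x.root, x.map.mem_ballVerts_self _ R⟩).1 = y.root

/-- The balls of radius `R` around the first roots contain the second roots, and are isomorphic as
doubly-rooted marked maps. -/
def DoublyRooted.Agree (R : ℕ) (x y : DoublyRooted X) : Prop :=
  ∃ φ : MarkedMap.Iso (x.map.ball x.fst R).toMap (y.map.ball y.fst R).toMap,
    (φ.v ⟨x.fst, x.map.mem_ballVerts_self _ R⟩).1 = y.fst ∧
    ∃ h : x.snd ∈ x.map.ballVerts x.fst R, (φ.v ⟨x.snd, h⟩).1 = y.snd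

/-- The local topology, for a discrete space of marks. -/
instance (X : Type) : TopologicalSpace (RootedClass X) :=
  .generateFrom {U | ∃ (x : Rooted X) (R : ℕ), U = {q | ∃ y, q = y.cls ∧ x.Agree R y}}

/-- The local topology, for a discrete space of marks. -/
instance (X : Type) : TopologicalSpace (DoublyRootedClass X) :=
  .generateFrom {U | ∃ (x : DoublyRooted X) (R : ℕ), U = {q | ∃ y, q = y.cls ∧ x.Agree R y}}

instance (X : Type) : MeasurableSpace (RootedClass X) := borel _

instance (X : Type) : MeasurableSpace (DoublyRootedClass X) := borel _

instance (X : Type) : BorelSpace (RootedClass X) := ⟨rfl⟩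

instance (X : Type) : BorelSpace (DoublyRootedClass X) := ⟨rfl⟩

/-! ### Unimodularity and average curvature -/

/-- A rooted map that depends on `a ∈ Ω` is a unimodular random rooted map if its isomorphism class
is a random variable that satisfies the mass transport principle. -/
structure IsUnimodular {Ω : Type*} [MeasurableSpace Ω] (P : Measure Ω) (W : Ω → Rooted X) :
    Prop where
  measurable : Measurable fun a => (W a).cls
  massTransport : ∀ f : DoublyRootedClass X → ℝ≥0∞, Measurable f →
    ∫⁻ a, ∑' v : (W a).map.V, f (DoublyRooted.cls ⟨(W a).map, (W a).root, v⟩) ∂P =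
      ∫⁻ a, ∑' u : (W a).map.V, f (DoublyRooted.cls ⟨(W a).map, u, (W a).root⟩) ∂P

/-- The underlying rooted map `(M, ρ)` of a rooted marked map. -/
def Rooted.forget (x : Rooted X) : Rooted Unit := ⟨x.map.forget, x.root⟩

/-- The degree of the root. -/
def Rooted.degree (x : Rooted X) : ℕ := x.map.degree x.root

/-- The curvature at the root. -/
def Rooted.curvature (x : Rooted X) : ℝ := x.map.curvature x.root

/-- The average curvature: the expected curvature at the root. -/
def averageCurvature {Ω : Type*} [MeasurableSpace Ω] (P : Measure Ω) (W : Ω → Rooted X) : ℝ :=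
  ∫ a, (W a).curvature ∂P

/-! ### Percolation: the marks are `true` (open) and `false` (closed) -/

/-- The relation of being joined by an open edge. -/
def MarkedMap.OpenAdj (M : MarkedMap Bool) (a b : M.V) : Prop :=
  ∃ e, M.emark e = true ∧ M.tail e = a ∧ M.tail (M.rev e) = b

/-- The cluster of `v`: its connected component in the subgraph of the open edges. -/
def MarkedMap.cluster (M : MarkedMap Bool) (v : M.V) : M.Sub where
  verts := {u | Relation.ReflTransGen M.OpenAdj v u}
  darts := {e | M.emark e = true ∧ Relation.ReflTransGen M.OpenAdj v (M.tail e)}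
  tail_mem _ he := he.2
  rev_mem e he := ⟨by rw [M.emark_rev]; exact he.1, he.2.tail ⟨e, he.1, rfl, rfl⟩⟩
  nonempty := ⟨v, .refl⟩
  connected := by
    refine M.connected_of_base _
      (fun e (he : _ ∧ _) => ⟨by rw [M.emark_rev]; exact he.1, he.2.tail ⟨e, he.1, rfl, rfl⟩⟩) _ v ?_
    intro u hu
    induction hu with
    | refl => exact .refl
    | tail h hbc ih =>
      obtain ⟨e, he, rfl, rfl⟩ := hbc
      exact ih.tail ⟨e, ⟨he, h⟩, rfl, rfl⟩

/-- A bond percolation: every vertex is open. -/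
def MarkedMap.IsBond (M : MarkedMap Bool) : Prop := ∀ v, M.vmark v = true

/-- A connected percolation: all open vertices lie in one cluster. -/
def MarkedMap.IsConnectedPercolation (M : MarkedMap Bool) : Prop :=
  ∀ u v, M.vmark u = true → M.vmark v = true → v ∈ (M.cluster u).verts

/-- The cluster of the root, as a rooted map: the map `(ω, ρ)` if `ω` is a connected bond
percolation. -/
def Rooted.rootCluster (x : Rooted Bool) : Rooted Unit :=
  ⟨(x.map.cluster x.root).toMap.forget, ⟨x.root, .refl⟩⟩

end RandomMap

end

/-! A corner of a face of degree d has angle π − 2π/d, so the curvature at the root is 2π − π·deg(ρ)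
+ 2π·Σ 1/deg(f_e), summed over the oriented edges at ρ (`curvature_eq`, `cluster_curvature_eq`). The
theorem therefore amounts to `IsUnimodular.two_mul_meanStar_faceInv`: the mean of Σ 1/deg(f_e) in M
exceeds the same mean in ω, taken over open edges, by half the mean number of closed oriented edges
at ρ. In a finite map this is the remark that each edge added inside a disc creates one new face.

To localise the count, every oriented edge e receives a `share`. A face of ω is a disc, and a closed
edge cuts it in two; the share of a closed e is the proportion of the boundary of the face of ω that
lies to the right of e, and an open e has the inverse degree of its face of ω. If the face of ω is
infinite, a closed e has share 1 or 0 according to whether infinity is on its right. Three facts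
carry the proof. The shares of e and −e add up to 1 if e is closed (`share_add_share_rev`). The
shares of the sides of a finite face of M add up to 1, because each boundary piece is seen from the
face through exactly one side (`existsUnique_toward`, `sum_share`). On an infinite face of M all
shares vanish (`share_eq_zero`). Mass transport makes the mean sum over the star of the root
invariant under reversal and under rotation around faces, so the mean total share equals the mean
total inverse degree in M (`meanStar_share`), while its closed part is half the mean number of
closed oriented edges.

The topology enters only through `HasSides`. The oriented edges in one face of ω form one orbit of
the permutation `walk`, by the single-orbit condition. The two sides of a closed edge come from a
circle-valued function on the complement of ω that winds once across that edge: on a disc it lifts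
to the line, and the lift jumps only there (`exists_right_side`).

For measurability, maps are rooted at an oriented edge and observed through finite words in reversal
and rotation. Isomorphic balls give the same observations, so sums over the star of the root are
Borel functions of the rooted map. -/

noncomputable section

namespace RandomMap

namespace MarkedMap
variable {X : Type} {M : MarkedMap X}

/-! ### The complement of a spanning subgraph in the surface -/

/-- The coordinates, in the panel of `e`, of the points off the image of `H`. -/
def Sub.offPanel (H : M.Sub) (e : M.D) : Set (ℝ × ℝ) :=
  {p | p ∈ M.panel e ∧ (0 < p.2 ∨ (e ∉ H.darts ∧ 0 < p.1 ∧ p.1 < 1))}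

lemma Sub.rev_mem_iff (H : M.Sub) (e : M.D) : M.rev e ∈ H.darts ↔ e ∈ H.darts :=
  ⟨fun h => M.rev_rev e ▸ H.rev_mem _ h, H.rev_mem e⟩

lemma Sub.offPanel_glue (H : M.Sub) {a b : Σ e : M.D, M.panel e} (h : M.Glue a b) :
    (a.2.1 ∈ H.offPanel a.1) = (b.2.1 ∈ H.offPanel b.1) := by
  refine propext ?_
  cases h with
  | side e t h h' => simp [Sub.offPanel, h, h']
  | edge e x h h' => simp [Sub.offPanel, h, h', H.rev_mem_iff, and_comm]
  | apex e e' x x' he h h' => simp [Sub.offPanel, h, h']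

/-- The points of the surface off the image of `H`, described in coordinates. -/
def Sub.Off (H : M.Sub) : M.Surface → Prop :=
  Quot.lift (fun a => a.2.1 ∈ H.offPanel a.1) fun _ _ h => H.offPanel_glue h

lemma Sub.off_point (H : M.Sub) (e : M.D) (p : M.panel e) :
    H.Off (M.point e p) ↔ p.1 ∈ H.offPanel e := Iff.rfl

lemma Sub.compl_image (H : M.Sub) (hv : H.verts = univ) : H.imageᶜ = {q | H.Off q} := by
  ext q
  obtain ⟨⟨e, p⟩, rfl⟩ := Quot.exists_rep q
  change M.point e p ∉ H.image ↔ H.Off (M.point e p)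
  constructor
  · intro h
    rw [H.off_point]
    by_contra h'
    obtain ⟨⟨x, t⟩, hp⟩ := p
    have hp' := hp
    obtain ⟨h0, h1, h2, h3, h4⟩ := hp
    simp only [Sub.offPanel, mem_ofPred_eq, not_and_or, not_or, not_lt] at h' h0 h1 h2 h3
    have h5 := h'.resolve_left (fun h => h hp')
    obtain ⟨h6, h7⟩ := h5
    have ht : t = 0 := le_antisymm h6 h2
    subst ht
    refine h ?_
    by_cases he : e ∈ H.darts
    · exact Or.inl (mem_biUnion he ⟨_, rfl, rfl⟩)
    · rcases (h7.resolve_left (fun h => h he)) with hx | hx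
      · obtain rfl : x = 0 := le_antisymm hx h0
        exact Or.inr ⟨e, hv ▸ mem_univ _, rfl⟩
      · obtain rfl : x = 1 := le_antisymm h1 hx
        -- The head of e is the tail of the next oriented edge around the face.
        exact Or.inr ⟨M.dualPerm e, hv ▸ mem_univ _, Quot.sound (Glue.side e 0 _ _)⟩
  · rintro h (h' | ⟨e', -, h'⟩)
    · obtain ⟨e', he', p', hp', h'⟩ := mem_iUnion₂.1 h'
      rw [h', H.off_point] at h
      simp only [Sub.offPanel, mem_ofPred_eq, hp', lt_self_iff_false, false_or] at h
      exact h.2.1 he'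
    · rw [h', tailPoint, H.off_point] at h
      simp [Sub.offPanel] at h

/-- Convexity is used for connectedness: a whole panel lies in one face of `H`, and two lifts over a
panel that agree at one point agree everywhere. -/
lemma Sub.convex_offPanel (H : M.Sub) (e : M.D) : Convex ℝ (H.offPanel e) := by
  rintro ⟨x, t⟩ ⟨⟨h1, h2, h3, h4, h5⟩, h6⟩ ⟨x', t'⟩ ⟨⟨h1', h2', h3', h4', h5'⟩, h6'⟩ a b ha hb hab
  simp only at h1 h2 h3 h4 h5 h6 h1' h2' h3' h4' h5' h6'
  have hb' : b = 1 - a := by linarith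
  subst hb'
  rcases eq_or_lt_of_le ha with rfl | ha
  · simpa using ⟨⟨h1', h2', h3', h4', h5'⟩, h6'⟩
  rcases eq_or_lt_of_le hb with hb | hb
  · obtain rfl : a = 1 := by linarith
    simpa using ⟨⟨h1, h2, h3, h4, h5⟩, h6⟩
  simp only [Sub.offPanel, panel, mem_ofPred_eq, Prod.smul_mk, Prod.mk_add_mk, smul_eq_mul]
  refine ⟨⟨by positivity, by nlinarith, by positivity, by nlinarith, fun h => h5 ?_⟩, ?_⟩
  · nlinarith
  · rcases h6 with h6 | ⟨he, h6, h7⟩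
    · left; positivity
    rcases h6' with h6' | ⟨he', h6', h7'⟩
    · left; positivity
    · exact Or.inr ⟨he, by positivity, by nlinarith⟩

/-- The panel of `e` without the image of `H`, as a part of the surface. -/
def Sub.panelMap (H : M.Sub) (e : M.D) (p : H.offPanel e) : M.Surface := M.point e ⟨p.1, p.2.1⟩

lemma continuous_point (e : M.D) : Continuous (M.point e) :=
  continuous_quot_mk.comp (continuous_sigmaMk (σ := fun e : M.D => M.panel e))

lemma Sub.continuous_panelMap (H : M.Sub) (e : M.D) : Continuous (H.panelMap e) :=
  (M.continuous_point e).comp (by fun_prop)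

lemma mem_panel_of_lt (e : M.D) {x t : ℝ} (h0 : 0 ≤ x) (h1 : x ≤ 1) (h2 : 0 ≤ t) (h3 : t < 1) :
    (x, t) ∈ M.panel e := ⟨h0, h1, h2, h3.le, fun h => absurd h h3.ne⟩

lemma Sub.center_mem (H : M.Sub) (e : M.D) : ((1 / 2 : ℝ), (1 / 2 : ℝ)) ∈ H.offPanel e :=
  ⟨M.mem_panel_of_lt e (by norm_num) (by norm_num) (by norm_num) (by norm_num),
    Or.inl (by norm_num)⟩

lemma Sub.side_mem (H : M.Sub) (e : M.D) {x : ℝ} (h0 : 0 ≤ x) (h1 : x ≤ 1) :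
    (x, (1 / 2 : ℝ)) ∈ H.offPanel e :=
  ⟨M.mem_panel_of_lt e h0 h1 (by norm_num) (by norm_num), Or.inl (by norm_num)⟩

lemma Sub.edge_mem (H : M.Sub) {e : M.D} (he : e ∉ H.darts) :
    ((1 / 2 : ℝ), (0 : ℝ)) ∈ H.offPanel e :=
  ⟨M.mem_panel_of_lt e (by norm_num) (by norm_num) (by norm_num) (by norm_num),
    Or.inr ⟨he, by norm_num, by norm_num⟩⟩

lemma Sub.panelMap_side (H : M.Sub) (e : M.D) :
    H.panelMap e ⟨(1, 1 / 2), H.side_mem e (by norm_num) le_rfl⟩ =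
      H.panelMap (M.dualPerm e) ⟨(0, 1 / 2), H.side_mem _ le_rfl (by norm_num)⟩ :=
  Quot.sound (Glue.side e (1 / 2) _ _)

lemma Sub.panelMap_edge (H : M.Sub) {e : M.D} (he : e ∉ H.darts) :
    H.panelMap e ⟨(1 / 2, 0), H.edge_mem he⟩ =
      H.panelMap (M.rev e) ⟨(1 / 2, 0), H.edge_mem ((H.rev_mem_iff e).not.2 he)⟩ := by
  have := Quot.sound (Glue.edge (M := M) e (1 / 2) (H.edge_mem he).1
    (M.mem_panel_of_lt _ (by norm_num) (by norm_num) (by norm_num) (by norm_num)))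
  refine this.trans ?_
  simp only [panelMap, point]
  congr 4
  norm_num

/-- The face of `H` that contains the face of `M` to the left of `e`. -/
def Sub.faceOf (H : M.Sub) (e : M.D) : Set M.Surface :=
  connectedComponentIn H.imageᶜ (M.leftPoint e)

section spanning
variable {H : M.Sub} (hv : H.verts = univ)
include hv

lemma Sub.leftPoint_mem (e : M.D) : M.leftPoint e ∈ H.imageᶜ := by
  rw [H.compl_image hv]
  exact H.center_mem e

lemma Sub.faceOf_mem_faces (e : M.D) : H.faceOf e ∈ H.faces := ⟨_, H.leftPoint_mem hv e, rfl⟩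

lemma Sub.range_panelMap_subset (e : M.D) : range (H.panelMap e) ⊆ H.faceOf e := by
  have : PreconnectedSpace (H.offPanel e) :=
    Subtype.preconnectedSpace (H.convex_offPanel e).isPreconnected
  refine (isPreconnected_range (H.continuous_panelMap e)).subset_connectedComponentIn
    ⟨⟨_, H.center_mem e⟩, rfl⟩ ?_
  rw [H.compl_image hv]
  rintro _ ⟨p, rfl⟩
  exact p.2

lemma Sub.faceOf_eq_of_mem {e e' : M.D} {q : M.Surface} (h : q ∈ range (H.panelMap e))
    (h' : q ∈ range (H.panelMap e')) : H.faceOf e' = H.faceOf e :=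
  (connectedComponentIn_eq (H.range_panelMap_subset hv e' h')).trans
    (connectedComponentIn_eq (H.range_panelMap_subset hv e h)).symm

lemma Sub.faceOf_dualPerm (e : M.D) : H.faceOf (M.dualPerm e) = H.faceOf e :=
  H.faceOf_eq_of_mem hv ⟨_, rfl⟩ ⟨_, (H.panelMap_side e).symm⟩

lemma Sub.faceOf_rev {e : M.D} (he : e ∉ H.darts) : H.faceOf (M.rev e) = H.faceOf e :=
  H.faceOf_eq_of_mem hv ⟨_, rfl⟩ ⟨_, (H.panelMap_edge he).symm⟩

lemma Sub.leftPoint_mem_faceOf (e e' : M.D) :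
    M.leftPoint e' ∈ H.faceOf e ↔ H.faceOf e' = H.faceOf e :=
  ⟨fun h => (connectedComponentIn_eq h).symm,
    fun h => h ▸ mem_connectedComponentIn (H.leftPoint_mem hv e')⟩

/-- Openness allows the continuity of a function on the complement to be tested in the panels,
through the quotient map. -/
lemma Sub.isOpen_compl_image : IsOpen H.imageᶜ := by
  rw [H.compl_image hv]
  change IsOpen (Quot.mk M.Glue ⁻¹' {q | H.Off q})
  rw [isOpen_sigma_iff]
  intro e
  have : (Sigma.mk e ⁻¹' (Quot.mk M.Glue ⁻¹' {q | H.Off q})) =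
      {p : M.panel e | 0 < p.1.2 ∨ (e ∉ H.darts ∧ 0 < p.1.1 ∧ p.1.1 < 1)} := by
    ext p
    exact ⟨fun h => h.2, fun h => ⟨p.2, h⟩⟩
  rw [this]
  have h1 : IsOpen {p : M.panel e | 0 < p.1.2} := isOpen_lt (by fun_prop) (by fun_prop)
  refine h1.union ?_
  exact isOpen_const.and ((isOpen_lt (by fun_prop) (by fun_prop)).and
    (isOpen_lt (by fun_prop) (by fun_prop)))

end spanning

/-! ### Crossing an edge once -/

/-- A function on the unit square that is `1` on the lower side and `0` on the other ones. -/
def bump (p : ℝ × ℝ) : ℝ :=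
  p.1 * (1 - p.1) * (1 - p.2) / (p.2 + p.1 * (1 - p.1) * (1 - p.2))

lemma bump_symm (x : ℝ) : bump (1 - x, 0) = bump (x, 0) := by
  simp only [bump]; congr 1 <;> ring

/-- The denominator vanishes only at the two lower corners of the square. These are vertices of the
map, and `offPanel` omits them. -/
lemma Sub.continuousOn_bump (H : M.Sub) (e : M.D) : ContinuousOn bump (H.offPanel e) := by
  refine ContinuousOn.div (by fun_prop) (by fun_prop) ?_
  rintro ⟨x, t⟩ ⟨⟨h1, h2, h3, h4, -⟩, h⟩
  simp only at h1 h2 h3 h4 h ⊢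
  have h5 : 0 ≤ x * (1 - x) * (1 - t) :=
    mul_nonneg (mul_nonneg h1 (by linarith)) (by linarith)
  rcases h with h | ⟨-, h, h'⟩
  · linarith
  · rcases eq_or_lt_of_le h3 with rfl | h3
    · have : 0 < x * (1 - x) := mul_pos h (by linarith)
      simpa using this.ne'
    · linarith

open Classical in
/-- The sign with which the dart `a` crosses the edge of `e`. -/
def crossSign (M : MarkedMap X) (e a : M.D) : ℝ := if a = e then -1 else if a = M.rev e then 1 else 0

lemma crossSign_rev (e a : M.D) : M.crossSign e (M.rev a) = - M.crossSign e a := by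
  have h1 : M.rev a = e ↔ a = M.rev e :=
    ⟨fun h => by rw [← h, M.rev_rev], fun h => by rw [h, M.rev_rev]⟩
  have h2 : M.rev a = M.rev e ↔ a = e := M.revPerm.injective.eq_iff
  have h3 := M.rev_ne e
  simp only [crossSign, h1, h2]
  split_ifs with ha hb <;> simp_all

/-- A circle-valued function on the surface that winds once when the edge of `e` is crossed. -/
def winding (M : MarkedMap X) (e : M.D) : M.Surface → AddCircle (2 : ℝ) :=
  Quot.lift (fun a => ((M.crossSign e a.1 * bump a.2.1 : ℝ) : AddCircle (2 : ℝ))) (by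
    intro a b h
    cases h with
    | side a t h h' => simp [bump]
    | edge a x h h' =>
      simp only [crossSign_rev, bump_symm]
      rw [← sub_eq_zero, ← AddCircle.coe_sub, AddCircle.coe_eq_zero_iff]
      by_cases hx : x * (1 - x) = 0
      · exact ⟨0, by simp [bump, hx]⟩
      · have : bump (x, 0) = 1 := by simp [bump, hx]
        simp only [this, crossSign]
        split_ifs
        -- On the edge of e the two panels give −1 and 1, which agree in a circle of length 2. This
        -- is why the circumference is 2.
        · exact ⟨-1, by norm_num⟩
        · exact ⟨1, by norm_num⟩
        · exact ⟨0, by norm_num⟩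
    | apex a a' x x' ha h h' => simp [bump])

lemma Sub.continuousOn_winding {H : M.Sub} (hv : H.verts = univ) (e : M.D) :
    ContinuousOn (M.winding e) H.imageᶜ := by
  have hq : Topology.IsQuotientMap (Quot.mk M.Glue) := isQuotientMap_quot_mk
  refine (hq.continuousOn_isOpen_iff (H.isOpen_compl_image hv)).2 ?_
  have hU := (H.isOpen_compl_image hv).preimage hq.continuous
  rw [hU.continuousOn_iff]
  rintro ⟨a, p⟩ hp
  rw [(Topology.IsOpenEmbedding.sigmaMk (σ := fun e : M.D => M.panel e)).continuousAt_iff.symm]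
  have hp' : p.1 ∈ H.offPanel a := (H.compl_image hv).le hp
  have : ContinuousWithinAt (fun p : ℝ × ℝ => ((M.crossSign e a * bump p : ℝ) : AddCircle (2 : ℝ)))
      (H.offPanel a) p.1 :=
    (AddCircle.continuous_mk' (2 : ℝ)).continuousAt.comp_continuousWithinAt
      (continuousWithinAt_const.mul (H.continuousOn_bump a _ hp'))
  have h2 : ContinuousWithinAt (fun p : M.panel a =>
      ((M.crossSign e a * bump p.1 : ℝ) : AddCircle (2 : ℝ)))
      ((fun p => (⟨a, p⟩ : Σ e : M.D, M.panel e)) ⁻¹' (Quot.mk M.Glue ⁻¹' H.imageᶜ)) p := by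
    refine ContinuousWithinAt.comp (f := fun p : M.panel a => p.1) (t := H.offPanel a) this
      continuous_subtype_val.continuousWithinAt ?_
    intro p' hp'
    exact (H.compl_image hv).le hp'
  exact h2.continuousAt ((hU.preimage continuous_sigmaMk).mem_nhds hp)

/-- A continuous circle-valued function on a disc lifts to the line. -/
lemma exists_lift_of_disc {Y : Type} [TopologicalSpace Y]
    (φ : Y ≃ₜ Metric.ball (0 : ℂ) 1) (g : Y → AddCircle (2 : ℝ)) (hg : Continuous g) :
    ∃ θ : Y → ℝ, Continuous θ ∧ ∀ y, (θ y : AddCircle (2 : ℝ)) = g y := by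
  have hc : Convex ℝ (Metric.ball (0 : ℂ) 1) := convex_ball _ _
  have : ContractibleSpace (Metric.ball (0 : ℂ) 1) :=
    hc.contractibleSpace ⟨0, by simp⟩
  have : LocallyPathConnectedSpace (Metric.ball (0 : ℂ) 1) :=
    Metric.isOpen_ball.locallyPathConnectedSpace
  let f : C(Metric.ball (0 : ℂ) 1, AddCircle (2 : ℝ)) := ⟨g ∘ φ.symm, hg.comp φ.symm.continuous⟩
  obtain ⟨e₀, he₀⟩ := QuotientAddGroup.mk_surjective (f ⟨0, by simp⟩)
  obtain ⟨F, ⟨-, hF⟩, -⟩ := (AddCircle.isCoveringMap_coe (2 : ℝ)).existsUnique_continuousMap_lifts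
    f ⟨0, by simp⟩ e₀ he₀
  refine ⟨F ∘ φ, F.continuous.comp φ.continuous, fun y => ?_⟩
  have := congrFun hF (φ y)
  simpa [f] using this

/-- The edge of `e` cuts the face of `H` that contains it into two parts; `R` is the part to the
right of `e`. -/
theorem Sub.exists_right_side {H : M.Sub} (hv : H.verts = univ) (hH : H.IsSubmap) {e : M.D}
    (he : e ∉ H.darts) : ∃ R : Set M.D, e ∉ R ∧ M.rev e ∈ R ∧
      (∀ a, H.faceOf a = H.faceOf e → (M.dualPerm a ∈ R ↔ a ∈ R)) ∧
      ∀ a, H.faceOf a = H.faceOf e → a ∉ H.darts → a ≠ e → a ≠ M.rev e →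
        (M.rev a ∈ R ↔ a ∈ R) := by
  obtain ⟨φ⟩ := hH.disc _ (H.faceOf_mem_faces hv e)
  have hsub : H.faceOf e ⊆ H.imageᶜ := connectedComponentIn_subset _ _
  obtain ⟨θ, hθ, hθg⟩ := exists_lift_of_disc φ ((H.faceOf e).domRestrict (M.winding e))
    ((H.continuousOn_winding hv e).mono hsub).domRestrict
  have hmem : ∀ a, H.faceOf a = H.faceOf e → ∀ p, H.panelMap a p ∈ H.faceOf e :=
    fun a ha p => ha ▸ H.range_panelMap_subset hv a ⟨p, rfl⟩
  -- On every panel of the face the lift is the explicit formula plus a constant. These constants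
  -- record on which side of e the panel lies.
  have key : ∀ a, ∃ c : ℝ, ∀ ha : H.faceOf a = H.faceOf e, ∀ p : H.offPanel a,
      θ ⟨H.panelMap a p, hmem a ha p⟩ = c + M.crossSign e a * bump p.1 := by
    intro a
    by_cases ha : H.faceOf a = H.faceOf e
    swap
    · exact ⟨0, fun h => absurd h ha⟩
    have : PreconnectedSpace (H.offPanel a) :=
      Subtype.preconnectedSpace (H.convex_offPanel a).isPreconnected
    let p₀ : H.offPanel a := ⟨_, H.center_mem a⟩
    let f₁ : H.offPanel a → ℝ := fun p => θ ⟨H.panelMap a p, hmem a ha p⟩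
    let c := f₁ p₀ - M.crossSign e a * bump p₀.1
    let f₂ : H.offPanel a → ℝ := fun p => c + M.crossSign e a * bump p.1
    have h₁ : Continuous f₁ := hθ.comp ((H.continuous_panelMap a).subtype_mk _)
    have h₂ : Continuous f₂ :=
      continuous_const.add (continuous_const.mul (H.continuousOn_bump a).domRestrict)
    have hf₁ : ∀ p, (f₁ p : AddCircle (2 : ℝ)) =
        ((M.crossSign e a * bump p.1 : ℝ) : AddCircle (2 : ℝ)) := fun p => hθg _
    have hc : (c : AddCircle (2 : ℝ)) = 0 := by
      rw [AddCircle.coe_sub, hf₁, sub_self]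
    -- Both are lifts of the same circle-valued map on a connected panel, and they agree at its
    -- centre.
    have : f₁ = f₂ := by
      refine (AddCircle.isCoveringMap_coe (2 : ℝ)).eq_of_comp_eq h₁ h₂ ?_ p₀ (by simp [f₂, c])
      funext p
      simp only [Function.comp_apply, hf₁, f₂]
      rw [AddCircle.coe_add, hc, zero_add]
    exact ⟨c, fun _ p => congrFun this p⟩
  choose c hc using key
  have hside : ∀ a, H.faceOf a = H.faceOf e → c (M.dualPerm a) = c a := by
    intro a ha
    have h1 := hc a ha ⟨(1, 1 / 2), H.side_mem a (by norm_num) le_rfl⟩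
    have h2 := hc (M.dualPerm a) ((H.faceOf_dualPerm hv a).trans ha)
      ⟨(0, 1 / 2), H.side_mem _ le_rfl (by norm_num)⟩
    simp only [H.panelMap_side] at h1
    rw [h1] at h2
    simpa [bump] using h2.symm
  have hedge : ∀ a, H.faceOf a = H.faceOf e → a ∉ H.darts →
      c a + M.crossSign e a = c (M.rev a) - M.crossSign e a := by
    intro a ha ha'
    have h1 := hc a ha ⟨(1 / 2, 0), H.edge_mem ha'⟩
    have h2 := hc (M.rev a) ((H.faceOf_rev hv ha').trans ha)
      ⟨(1 / 2, 0), H.edge_mem ((H.rev_mem_iff a).not.2 ha')⟩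
    simp only [H.panelMap_edge ha'] at h1
    rw [h1, crossSign_rev] at h2
    have : bump (1 / 2, 0) = 1 := by norm_num [bump]
    rw [this] at h2
    linarith
  -- The constant is unchanged from panel to panel around a face of M and across every closed edge
  -- except that of e, where `hedge` gives a jump of 2.
  refine ⟨{a | c a = c (M.rev e)}, ?_, rfl, ?_, ?_⟩
  · intro h
    have h1 := hedge e rfl he
    have h2 : c e = c (M.rev e) := h
    have : M.crossSign e e = -1 := by simp [crossSign]
    rw [h2, this] at h1
    linarith
  · intro a ha
    simp only [mem_ofPred_eq, hside a ha]
  · intro a ha ha' h1 h2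
    have h := hedge a ha ha'
    have h0 : M.crossSign e a = 0 := by simp [crossSign, h1, h2]
    rw [h0, add_zero, sub_zero] at h
    simp only [mem_ofPred_eq, h]

end MarkedMap

/-! ### Orbits of permutations -/

section orbits
open Function
variable {D : Type} {s : Equiv.Perm D} {a b : D}

/-- The main tool for all orbit arguments below: a set that one step neither enters nor leaves along
the orbit contains all of the orbit or none of it. -/
lemma mem_iff_of_sameCycle {Z : Set D} (h : s.SameCycle a b)
    (hZ : ∀ x, s.SameCycle a x → (s x ∈ Z ↔ x ∈ Z)) : b ∈ Z ↔ a ∈ Z := by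
  obtain ⟨i, rfl⟩ := h
  induction i using Int.induction_on with
  | zero => simp
  | succ i ih =>
    rw [add_comm, zpow_add, zpow_one, Equiv.Perm.mul_apply, hZ _ ⟨i, rfl⟩, ih]
  | pred i ih =>
    rw [← hZ _ ⟨_, rfl⟩, ← Equiv.Perm.mul_apply, ← zpow_one_add, ← ih]
    congr! 3
    ring

lemma sameCycle_iterate (s : Equiv.Perm D) (a : D) (k : ℕ) : s.SameCycle a (s^[k] a) :=
  ⟨k, by rw [zpow_natCast, Equiv.Perm.coe_pow]⟩

lemma sameCycle_step (s : Equiv.Perm D) (a : D) : s.SameCycle a (s a) := ⟨1, by simp⟩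

lemma minimalPeriod_perm_apply (s : Equiv.Perm D) (x : D) :
    minimalPeriod s (s x) = minimalPeriod s x := by
  refine minimalPeriod_eq_minimalPeriod_iff.2 fun n => ?_
  rw [IsPeriodicPt, IsPeriodicPt, IsFixedPt, IsFixedPt, ← iterate_succ_apply, iterate_succ_apply',
    s.injective.eq_iff]

lemma minimalPeriod_eq_of_sameCycle (h : s.SameCycle a b) :
    minimalPeriod s b = minimalPeriod s a :=
  (mem_iff_of_sameCycle (Z := {x | minimalPeriod s x = minimalPeriod s a}) h fun x _ => by
    simp only [mem_ofPred_eq, minimalPeriod_perm_apply]).2 rfl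

lemma iterate_ne_of_minimalPeriod_eq_zero (h : minimalPeriod s a = 0) {k : ℕ} (hk : 0 < k) :
    s^[k] a ≠ a := fun h' => by
  have := IsPeriodicPt.minimalPeriod_pos hk h'
  omega

/-- Moving the starting point by one step only cycles the summands. On an infinite orbit
`minimalPeriod` is 0 and both sums are empty. -/
lemma sum_orbit_eq {A : Type*} [AddCommMonoid A] (h : s.SameCycle a b)
    (ψ : D → A) : ∑ k ∈ Finset.range (minimalPeriod s b), ψ (s^[k] b) =
      ∑ k ∈ Finset.range (minimalPeriod s a), ψ (s^[k] a) := by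
  let S : D → A := fun x => ∑ k ∈ Finset.range (minimalPeriod s x), ψ (s^[k] x)
  have hS : ∀ x, S (s x) = S x := by
    intro x
    simp only [S, minimalPeriod_perm_apply]
    rcases h0 : minimalPeriod s x with _ | n
    · simp
    · rw [Finset.sum_range_succ, Finset.sum_range_succ', ← iterate_succ_apply]
      have : s^[n + 1] x = x := h0 ▸ iterate_minimalPeriod
      simp [this]
  exact (mem_iff_of_sameCycle (Z := {x | S x = S a}) h fun x _ => by
    simp only [mem_ofPred_eq, hS]).2 rfl

lemma exists_iterate_of_sameCycle (h0 : minimalPeriod s a ≠ 0) (h : s.SameCycle a b) :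
    ∃ k < minimalPeriod s a, s^[k] a = b := by
  refine (mem_iff_of_sameCycle (Z := {x | ∃ k < minimalPeriod s a, s^[k] a = x}) h
    fun x _ => ⟨?_, ?_⟩).2 ⟨0, by omega, rfl⟩
  · rintro ⟨k, hk, hx⟩
    rcases k with _ | k
    · refine ⟨minimalPeriod s a - 1, by omega, s.injective ?_⟩
      rw [← iterate_succ_apply' s, Nat.succ_eq_add_one, Nat.sub_add_cancel (by omega),
        iterate_minimalPeriod, ← hx, iterate_zero_apply]
    · exact ⟨k, by omega, s.injective (by rw [← iterate_succ_apply' s, hx])⟩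
  · rintro ⟨k, hk, rfl⟩
    by_cases hk' : k + 1 = minimalPeriod s a
    · refine ⟨0, by omega, ?_⟩
      rw [← iterate_succ_apply' s, Nat.succ_eq_add_one, hk', iterate_minimalPeriod,
        iterate_zero_apply]
    · exact ⟨k + 1, by omega, by rw [iterate_succ_apply']⟩

lemma iterate_injOn (a : D) :
    (Iio (minimalPeriod s a)).InjOn fun k => s^[k] a := iterate_injOn_Iio_minimalPeriod

lemma orbit_eq_image (h0 : minimalPeriod s a ≠ 0) :
    {b | s.SameCycle a b} = (fun k => s^[k] a) '' Iio (minimalPeriod s a) := by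
  ext b
  refine ⟨fun h => exists_iterate_of_sameCycle h0 h, ?_⟩
  rintro ⟨k, -, rfl⟩
  exact sameCycle_iterate s a k

lemma finite_orbit_iff : {b | s.SameCycle a b}.Finite ↔ minimalPeriod s a ≠ 0 := by
  refine ⟨fun h h0 => ?_, fun h => ?_⟩
  · refine infinite_of_injective_forall_mem (f := fun k : ℕ => s^[k] a) ?_
      (fun k => sameCycle_iterate s a k) h
    intro i j hij
    wlog hlt : i ≤ j generalizing i j
    · exact (this hij.symm (by omega)).symm
    obtain ⟨k, rfl⟩ := Nat.exists_eq_add_of_le hlt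
    rcases k with _ | k
    · rfl
    · simp only [iterate_add_apply] at hij
      exact absurd ((s.injective.iterate i) hij).symm
        (iterate_ne_of_minimalPeriod_eq_zero h0 k.succ_pos)
  · rw [orbit_eq_image h]
    exact (finite_Iio _).image _

lemma ncard_orbit (h0 : minimalPeriod s a ≠ 0) :
    {b | s.SameCycle a b}.ncard = minimalPeriod s a := by
  rw [orbit_eq_image h0, (iterate_injOn a).ncard_image]
  simp [ncard_eq_toFinset_card']

lemma sum_orbit_ite_eq_one {A : Type*} [AddCommMonoidWithOne A]
    (h0 : minimalPeriod s a ≠ 0) {p : D → Prop} [DecidablePred p]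
    (h : ∃! b, s.SameCycle a b ∧ p b) :
    ∑ k ∈ Finset.range (minimalPeriod s a), (if p (s^[k] a) then (1 : A) else 0) = 1 := by
  obtain ⟨b, ⟨h1, h2⟩, h3⟩ := h
  obtain ⟨k, hk, rfl⟩ := exists_iterate_of_sameCycle h0 h1
  rw [Finset.sum_eq_single k, if_pos h2]
  · intro j hj hjk
    refine if_neg fun hp => hjk ?_
    exact iterate_injOn a (Finset.mem_range.1 hj) hk (h3 _ ⟨sameCycle_iterate s a j, hp⟩)
  · intro h
    exact absurd (Finset.mem_range.2 hk) h

end orbits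

namespace MarkedMap
open Function
variable (M : MarkedMap Bool)

/-! ### Walking around the faces of a percolation -/

open Classical in
/-- The reversal of the open oriented edges. -/
def openRev : Equiv.Perm M.D :=
  Involutive.toPerm (fun e => if M.emark e = true then M.rev e else e) fun e => by
    by_cases h : M.emark e = true <;> simp [h, M.emark_rev, M.rev_rev]

/-- The walk around the faces of the open subgraph: an oriented edge that is open is followed along
the face of `M` on its left, and one that is closed is crossed. -/
def walk : Equiv.Perm M.D := M.openRev.trans M.σ.symm

variable {M} {e a : M.D}

lemma walk_of_open (h : M.emark e = true) : M.walk e = M.dualPerm e := by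
  simp [walk, openRev, Involutive.toPerm, h, dualPerm, revPerm]

lemma walk_of_closed (h : M.emark e ≠ true) : M.walk e = M.dualPerm (M.rev e) := by
  simp only [Bool.not_eq_true] at h
  simp [walk, openRev, Involutive.toPerm, h, dualPerm, revPerm, M.rev_rev]

lemma closed_rev (h : M.emark e ≠ true) : M.emark (M.rev e) ≠ true := by rwa [M.emark_rev]

variable (M) in
/-- Every face of the open subgraph is a disc that is cut in two by each closed edge in it: the
oriented edges in a face of the open subgraph form one orbit of `walk`, and `R e` consists of those
to the right of the closed oriented edge `e`. -/
structure HasSides (R : M.D → Set M.D) : Prop where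
  exists_open : ∀ a, ∃ k, M.emark (M.walk^[k] a) = true
  sameCycle_dual : ∀ a, M.walk.SameCycle a (M.dualPerm a)
  sameCycle_rev : ∀ a, M.emark a ≠ true → M.walk.SameCycle a (M.rev a)
  notMem : ∀ e, M.emark e ≠ true → e ∉ R e
  rev_mem : ∀ e, M.emark e ≠ true → M.rev e ∈ R e
  dual_iff : ∀ e, M.emark e ≠ true → ∀ a, M.walk.SameCycle e a → (M.dualPerm a ∈ R e ↔ a ∈ R e)
  rev_iff : ∀ e, M.emark e ≠ true → ∀ a, M.walk.SameCycle e a → M.emark a ≠ true → a ≠ e →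
    a ≠ M.rev e → (M.rev a ∈ R e ↔ a ∈ R e)

namespace HasSides
variable {R : M.D → Set M.D} (hR : M.HasSides R)
include hR

lemma sameCycle_of_face (h : M.dualPerm.SameCycle e a) : M.walk.SameCycle e a :=
  (mem_iff_of_sameCycle (Z := {x | M.walk.SameCycle e x}) h fun x _ =>
    ⟨fun h => h.trans (hR.sameCycle_dual x).symm, fun h => h.trans (hR.sameCycle_dual x)⟩).2
    (Equiv.Perm.SameCycle.refl _ _)

/-- Going around a face of M crosses no edge, so the whole face stays on the left of each of its
closed sides. -/
lemma mem_iff_of_face (he : M.emark e ≠ true) (h : M.dualPerm.SameCycle e a) : a ∉ R e := by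
  rw [mem_iff_of_sameCycle (Z := R e) h fun x hx => hR.dual_iff e he x (hR.sameCycle_of_face hx)]
  exact hR.notMem e he

/-- The walk changes sides only when it crosses the edge of e itself. -/
lemma walk_mem_iff (he : M.emark e ≠ true) (ha : M.walk.SameCycle e a) (h1 : a ≠ e)
    (h2 : a ≠ M.rev e) : M.walk a ∈ R e ↔ a ∈ R e := by
  by_cases h : M.emark a = true
  · rw [walk_of_open h, hR.dual_iff e he a ha]
  · rw [walk_of_closed h, hR.dual_iff e he _ (ha.trans (hR.sameCycle_rev a h)),
      hR.rev_iff e he a ha h h1 h2]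

lemma walk_self_mem (he : M.emark e ≠ true) : M.walk e ∈ R e := by
  rw [walk_of_closed he, hR.dual_iff e he _ (hR.sameCycle_rev e he)]
  exact hR.rev_mem e he

lemma walk_rev_notMem (he : M.emark e ≠ true) : M.walk (M.rev e) ∉ R e := by
  rw [walk_of_closed (closed_rev he), M.rev_rev,
    hR.dual_iff e he _ (Equiv.Perm.SameCycle.refl _ _)]
  exact hR.notMem e he

/-- `HasSides` does not say that the sides chosen for e and −e are complementary. It follows because
both change at the same two places of the orbit, in opposite senses, and the claim holds at e. -/
lemma mem_rev_iff (he : M.emark e ≠ true) (ha : M.walk.SameCycle e a) :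
    a ∈ R (M.rev e) ↔ a ∉ R e := by
  have he' := closed_rev he
  have h1 := hR.rev_mem _ he'
  have h2 := hR.walk_rev_notMem he'
  have h3 := hR.sameCycle_rev e he
  rw [M.rev_rev] at h1 h2
  refine (mem_iff_of_sameCycle (Z := {a | a ∈ R (M.rev e) ↔ a ∉ R e}) ha fun x hx => ?_).2 ?_
  · simp only [mem_ofPred_eq]
    by_cases hx1 : x = e
    · subst hx1
      simp [h1, h2, hR.notMem x he, hR.walk_self_mem he]
    by_cases hx2 : x = M.rev e
    · subst hx2
      simp [hR.notMem _ he', hR.walk_self_mem he', hR.rev_mem e he, hR.walk_rev_notMem he]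
    rw [hR.walk_mem_iff he hx hx1 hx2, hR.walk_mem_iff he' (h3.symm.trans hx) hx2
      (by rwa [M.rev_rev])]
  · simp [h1, hR.notMem e he]

/-- Seen from an oriented edge `h` of a face of the open subgraph, each face of `M` inside it has
exactly one oriented edge that is `h` or has `h` on its right. -/
theorem existsUnique_toward {f h : M.D} (hf : M.walk.SameCycle f h) :
    ∃! e, M.dualPerm.SameCycle f e ∧ (h = e ∨ (M.emark e ≠ true ∧ h ∈ R e)) := by
  have key : ∀ e e', M.dualPerm.SameCycle f e → M.dualPerm.SameCycle f e' →
      M.emark e ≠ true → M.emark e' ≠ true → h ∈ R e → h ∈ R e' → e = e' := by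
    intro e e' hfe hfe' he he' hh hh'
    by_contra hne
    have hee' := hfe.symm.trans hfe'
    -- The side e lies on the left of e', and crossing e does not cross e', so −e is on the left of
    -- e' too.
    have haux : ∀ e e', M.dualPerm.SameCycle e e' → M.emark e ≠ true → M.emark e' ≠ true →
        e ≠ e' → M.rev e ∉ R e' := by
      intro e e' hee' he he' hne hmem
      by_cases h1 : e = M.rev e'
      · rw [h1, M.rev_rev] at hmem
        exact hR.notMem _ he' hmem
      · rw [hR.rev_iff e' he' e (hR.sameCycle_of_face hee'.symm) he hne h1] at hmem
        exact hR.mem_iff_of_face he' hee'.symm hmem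
    have hwalk := hR.sameCycle_of_face hee'
    have hstep : ∀ e e', M.dualPerm.SameCycle e e' → M.emark e ≠ true → M.emark e' ≠ true →
        e ≠ e' → M.walk e ∉ R e' := by
      intro e e' hee' he he' hne hmem
      rw [walk_of_closed he, hR.dual_iff e' he' _
        ((hR.sameCycle_of_face hee').symm.trans (hR.sameCycle_rev e he))] at hmem
      exact haux e e' hee' he he' hne hmem
    -- The common right side of two different sides of one face could be entered or left only at e,
    -- e' or their reversals, and each of these is ruled out. It is therefore stable under the walk,
    -- and it misses e.
    have hZ := mem_iff_of_sameCycle (Z := R e ∩ R e') (a := e) (b := h)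
      (s := M.walk) ((hR.sameCycle_of_face hfe).symm.trans hf) fun x hx => ?_
    · exact hR.notMem e he (hZ.1 ⟨hh, hh'⟩).1
    · constructor
      · rintro ⟨h1, h2⟩
        have hx1 : x ≠ e := by
          rintro rfl; exact hstep x e' hee' he he' hne h2
        have hx2 : x ≠ e' := by
          rintro rfl; exact hstep x e hee'.symm he' he (Ne.symm hne) h1
        have hx3 : x ≠ M.rev e := by
          rintro rfl; exact hR.walk_rev_notMem he h1
        have hx4 : x ≠ M.rev e' := by
          rintro rfl; exact hR.walk_rev_notMem he' h2
        exact ⟨(hR.walk_mem_iff he hx hx1 hx3).1 h1,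
          (hR.walk_mem_iff he' (hwalk.symm.trans hx) hx2 hx4).1 h2⟩
      · rintro ⟨h1, h2⟩
        have hx1 : x ≠ e := by
          rintro rfl; exact hR.notMem _ he h1
        have hx2 : x ≠ e' := by
          rintro rfl; exact hR.notMem _ he' h2
        have hx3 : x ≠ M.rev e := by
          rintro rfl; exact haux e e' hee' he he' hne h2
        have hx4 : x ≠ M.rev e' := by
          rintro rfl; exact haux e' e hee'.symm he' he (Ne.symm hne) h1
        exact ⟨(hR.walk_mem_iff he hx hx1 hx3).2 h1,
          (hR.walk_mem_iff he' (hwalk.symm.trans hx) hx2 hx4).2 h2⟩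
  by_cases hfh : M.dualPerm.SameCycle f h
  · refine ⟨h, ⟨hfh, Or.inl rfl⟩, ?_⟩
    rintro e ⟨hfe, rfl | ⟨he, hmem⟩⟩
    · rfl
    · exact absurd hmem (hR.mem_iff_of_face he (hfe.symm.trans hfh))
  -- Existence: the oriented edges in the face of M or to the right of one of its closed sides form
  -- a set that is stable under the walk and contains f.
  · have hex : h ∈ {x | M.dualPerm.SameCycle f x ∨
        ∃ e, M.dualPerm.SameCycle f e ∧ M.emark e ≠ true ∧ x ∈ R e} := by
      refine (mem_iff_of_sameCycle hf fun x hx => ⟨?_, ?_⟩).2 (Or.inl (.refl _ _))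
      · rintro (h1 | ⟨e, h1, he, h2⟩)
        · by_cases hxo : M.emark x = true
          · rw [walk_of_open hxo] at h1
            exact Or.inl (h1.trans (sameCycle_step _ _).symm)
          · rw [walk_of_closed hxo] at h1
            have := hR.rev_mem _ (closed_rev hxo)
            rw [M.rev_rev] at this
            exact Or.inr ⟨M.rev x, h1.trans (sameCycle_step _ _).symm, closed_rev hxo, this⟩
        · by_cases hx1 : x = e
          · exact Or.inl (hx1 ▸ h1)
          by_cases hx2 : x = M.rev e
          · exact absurd (hx2 ▸ h2) (hR.walk_rev_notMem he)
          exact Or.inr ⟨e, h1, he,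
            (hR.walk_mem_iff he ((hR.sameCycle_of_face h1).symm.trans hx) hx1 hx2).1 h2⟩
      · rintro (h1 | ⟨e, h1, he, h2⟩)
        · by_cases hxo : M.emark x = true
          · rw [mem_ofPred_eq, walk_of_open hxo]
            exact Or.inl (h1.trans (sameCycle_step _ _))
          · exact Or.inr ⟨x, h1, hxo, hR.walk_self_mem hxo⟩
        · by_cases hx2 : x = M.rev e
          · left
            rw [hx2, walk_of_closed (closed_rev he), M.rev_rev]
            exact h1.trans (sameCycle_step _ _)
          have hx1 : x ≠ e := by
            rintro rfl; exact hR.notMem _ he h2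
          exact Or.inr ⟨e, h1, he,
            (hR.walk_mem_iff he ((hR.sameCycle_of_face h1).symm.trans hx) hx1 hx2).2 h2⟩
    obtain ⟨e, h1, he, h2⟩ := hex.resolve_left hfh
    refine ⟨e, ⟨h1, Or.inr ⟨he, h2⟩⟩, ?_⟩
    rintro e' ⟨hfe', rfl | ⟨he', hmem⟩⟩
    · exact absurd hfe' hfh
    · exact key e' e hfe' h1 he' he hmem h2

end HasSides
end MarkedMap

/-! ### Shares: their definition, and their sums across an edge and around a face. -/

namespace MarkedMap
open Function
variable (M : MarkedMap Bool)

/-- The degree of the face of the open subgraph to the left of an open oriented edge `e`, if it is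
finite. -/
def openCount (e : M.D) : ℝ≥0∞ :=
  ∑ k ∈ Finset.range (minimalPeriod M.walk e), if M.emark (M.walk^[k] e) = true then 1 else 0

/-- In an infinite face of the open subgraph: the oriented edge `e` has infinity on its right. -/
def Inward (e : M.D) : Prop := ∃ k, M.walk^[k + 1] (M.rev e) = e

open Classical in
/-- The proportion of the boundary of the ambient face of the open subgraph that is to the right of
`e`, where an open oriented edge has only itself to its right. -/
def share (e : M.D) : ℝ≥0∞ :=
  if minimalPeriod M.walk e = 0 then (if M.emark e ≠ true ∧ M.Inward e then 1 else 0)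
  else (∑ k ∈ Finset.range (minimalPeriod M.walk e), if M.emark (M.walk^[k] e) = true ∧
    (k = 0 ∨ (M.emark e ≠ true ∧ ∀ j < k, M.walk^[j] e ≠ M.rev e)) then 1 else 0) / M.openCount e

/-- The inverse of the degree of the face to the left of `e`. -/
def faceInv (e : M.D) : ℝ≥0∞ :=
  if minimalPeriod M.dualPerm e = 0 then 0 else (minimalPeriod M.dualPerm e : ℝ≥0∞)⁻¹

/-- The inverse of the degree of the face of the open subgraph to the left of `e`. -/
def openFaceInv (e : M.D) : ℝ≥0∞ :=
  if minimalPeriod M.walk e = 0 then 0 else (M.openCount e)⁻¹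

variable {M} {e a : M.D}

lemma openCount_ne_top (e : M.D) : M.openCount e ≠ ∞ := by
  refine ENNReal.sum_ne_top.2 fun k _ => ?_
  split_ifs <;> simp

lemma openCount_eq_of_sameCycle (h : M.walk.SameCycle e a) : M.openCount a = M.openCount e :=
  sum_orbit_eq h fun x => if M.emark x = true then 1 else 0

lemma share_of_open (h : M.emark e = true) : M.share e = M.openFaceInv e := by
  rw [share, openFaceInv]
  split_ifs with h0 h1
  · exact absurd h h1.1
  · rfl
  · rw [Finset.sum_eq_single 0]
    · simp [h]
    · intro k _ hk
      simp [hk, h]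
    · intro h'
      exact absurd (Finset.mem_range.2 (Nat.pos_of_ne_zero h0)) h'

/-- An eventual property along the walk does not depend on the starting point. -/
lemma eventually_walk {Z : Set M.D} (h : M.walk.SameCycle a e) :
    (∃ J, ∀ j ≥ J, M.walk^[j] e ∈ Z) ↔ ∃ J, ∀ j ≥ J, M.walk^[j] a ∈ Z := by
  refine mem_iff_of_sameCycle (Z := {x | ∃ J, ∀ j ≥ J, M.walk^[j] x ∈ Z}) h
    fun x _ => ⟨?_, ?_⟩
  · rintro ⟨J, hJ⟩
    refine ⟨J + 1, fun j hj => ?_⟩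
    obtain ⟨i, rfl⟩ := Nat.exists_eq_add_of_le hj
    have := hJ (J + i) (by omega)
    rwa [← iterate_succ_apply, show (J + i).succ = J + 1 + i by omega] at this
  · rintro ⟨J, hJ⟩
    exact ⟨J, fun j hj => by rw [← iterate_succ_apply]; exact hJ _ (by omega)⟩

lemma eventually_ne (h0 : minimalPeriod M.walk e = 0) (h : M.walk.SameCycle a e) :
    ∃ J, ∀ j ≥ J, M.walk^[j] a ∈ {x | x ≠ e} := by
  rw [← eventually_walk h]
  exact ⟨1, fun j hj => iterate_ne_of_minimalPeriod_eq_zero h0 hj⟩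

namespace HasSides
variable {R : M.D → Set M.D} (hR : M.HasSides R)
include hR

lemma openCount_ne_zero (h0 : minimalPeriod M.walk e ≠ 0) : M.openCount e ≠ 0 := by
  obtain ⟨k, hk⟩ := hR.exists_open e
  rw [← iterate_mod_minimalPeriod_eq] at hk
  intro h
  have := (Finset.sum_eq_zero_iff.1 h) (k % minimalPeriod M.walk e)
    (Finset.mem_range.2 (Nat.mod_lt _ (Nat.pos_of_ne_zero h0)))
  exact one_ne_zero ((if_pos hk).symm.trans this)

/-- After e the walk is on the right of e until it meets −e, and then on the left for the rest of
the period. This identifies `share`, which is defined by the walk alone so as to be measurable, with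
the count in terms of the chosen sides `R`. -/
lemma iterate_mem_iff (he : M.emark e ≠ true) {k : ℕ} (hk : 0 < k)
    (hk' : k < minimalPeriod M.walk e) :
    M.walk^[k] e ∈ R e ↔ ∀ j < k, M.walk^[j] e ≠ M.rev e := by
  induction k with
  | zero => omega
  | succ k ih =>
    rcases k with _ | k
    · simpa [hR.walk_self_mem he] using (M.rev_ne e).symm
    have ih := ih k.succ_pos (by omega)
    have hne : M.walk^[k + 1] e ≠ e := fun h =>
      not_isPeriodicPt_of_pos_of_lt_minimalPeriod k.succ_ne_zero (by omega) h
    by_cases h : M.walk^[k + 1] e = M.rev e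
    · rw [iterate_succ_apply', h]
      refine iff_of_false (hR.walk_rev_notMem he) fun h' => h' (k + 1) (by omega) h
    · rw [iterate_succ_apply', hR.walk_mem_iff he (sameCycle_iterate _ _ _) hne h, ih]
      refine ⟨fun h1 j hj => ?_, fun h1 j hj => h1 j (by omega)⟩
      rcases Nat.lt_succ_iff_lt_or_eq.1 hj with hj | rfl
      · exact h1 j hj
      · exact h

open Classical in
lemma share_of_ne_zero (h0 : minimalPeriod M.walk e ≠ 0) : M.share e =
    (∑ k ∈ Finset.range (minimalPeriod M.walk e), if M.emark (M.walk^[k] e) = true ∧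
      (M.walk^[k] e = e ∨ (M.emark e ≠ true ∧ M.walk^[k] e ∈ R e)) then 1 else 0) /
      M.openCount e := by
  rw [share, if_neg h0]
  congr 1
  refine Finset.sum_congr rfl fun k hk => ?_
  rw [Finset.mem_range] at hk
  refine if_congr (and_congr_right fun _ => ?_) rfl rfl
  rcases Nat.eq_zero_or_pos k with rfl | hk0
  · simp
  have hne : M.walk^[k] e ≠ e := fun h =>
    not_isPeriodicPt_of_pos_of_lt_minimalPeriod hk0.ne' hk h
  simp only [hk0.ne', hne, false_or]
  exact and_congr_right fun he => (hR.iterate_mem_iff he hk0 hk).symm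

/-- An infinite orbit is ordered like the integers, so exactly one of e and −e comes first. -/
lemma inward_rev_iff (he : M.emark e ≠ true) (h0 : minimalPeriod M.walk e = 0) :
    M.Inward (M.rev e) ↔ ¬ M.Inward e := by
  constructor
  · rintro ⟨k, hk⟩ ⟨l, hl⟩
    rw [M.rev_rev] at hk
    rw [← hk, ← iterate_add_apply] at hl
    exact iterate_ne_of_minimalPeriod_eq_zero h0 (by omega) hl
  · intro h
    obtain ⟨i, hi⟩ := hR.sameCycle_rev e he
    rcases i with (_ | k) | k
    · exact absurd (by simpa using hi.symm) (M.rev_ne e)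
    · refine ⟨k, ?_⟩
      rw [M.rev_rev, ← Equiv.Perm.coe_pow, ← hi]
      rfl
    · refine absurd ⟨k, ?_⟩ h
      rw [← Equiv.Perm.coe_pow, ← hi, zpow_negSucc]
      simp

/-- The two parts into which a closed edge cuts a face of the open subgraph make up the whole
boundary. -/
theorem share_add_share_rev (he : M.emark e ≠ true) : M.share e + M.share (M.rev e) = 1 := by
  classical
  have hper : minimalPeriod M.walk (M.rev e) = minimalPeriod M.walk e :=
    minimalPeriod_eq_of_sameCycle (hR.sameCycle_rev e he)
  have he' := closed_rev he
  by_cases h0 : minimalPeriod M.walk e = 0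
  · rw [share, share, if_pos h0, if_pos (hper.trans h0)]
    simp only [he, he', hR.inward_rev_iff he h0, ne_eq]
    by_cases h : M.Inward e <;> simp [h]
  · have hcongr : ∀ e, M.emark e ≠ true → minimalPeriod M.walk e ≠ 0 → M.share e =
        (∑ k ∈ Finset.range (minimalPeriod M.walk e), if M.emark (M.walk^[k] e) = true ∧
          M.walk^[k] e ∈ R e then 1 else 0) / M.openCount e := by
      intro e he h0
      rw [hR.share_of_ne_zero h0]
      congr 1
      refine Finset.sum_congr rfl fun k _ => if_congr (and_congr_right fun h => ?_) rfl rfl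
      have : M.walk^[k] e ≠ e := fun h' => he (h' ▸ h)
      simp [he, this]
    rw [hcongr e he h0, hcongr _ he' (hper ▸ h0),
      openCount_eq_of_sameCycle (hR.sameCycle_rev e he),
      sum_orbit_eq (hR.sameCycle_rev e he)
        (fun x => if M.emark x = true ∧ x ∈ R (M.rev e) then (1 : ℝ≥0∞) else 0),
      ← ENNReal.add_div, ← Finset.sum_add_distrib]
    rw [ENNReal.div_eq_one_iff (hR.openCount_ne_zero h0) (openCount_ne_top e), openCount]
    refine Finset.sum_congr rfl fun k _ => ?_
    rw [hR.mem_rev_iff he (sameCycle_iterate _ _ _)]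
    by_cases h1 : M.emark (M.walk^[k] e) = true <;> by_cases h2 : M.walk^[k] e ∈ R e <;>
      simp [h1, h2]

/-- Beyond the later of e and −e the walk never crosses this edge again. If e is the later one, the
walk ends up on its right; otherwise it ends up on its left. -/
lemma eventually_mem_iff (he : M.emark e ≠ true) (h0 : minimalPeriod M.walk e = 0)
    (h : M.walk.SameCycle a e) :
    ∃ J, ∀ j ≥ J, M.walk^[j] a ∈ {x | x ∈ R e ↔ M.Inward e} := by
  have hrev := hR.sameCycle_rev e he
  by_cases hin : M.Inward e
  · rw [← eventually_walk h]
    refine ⟨1, fun j hj => ?_⟩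
    simp only [mem_ofPred_eq, hin, iff_true]
    induction j, hj using Nat.le_induction with
    | base => exact hR.walk_self_mem he
    | succ j hj ih =>
      rw [iterate_succ_apply', hR.walk_mem_iff he (sameCycle_iterate _ _ _)
        (iterate_ne_of_minimalPeriod_eq_zero h0 hj) ?_]
      · exact ih
      · intro h'
        obtain ⟨k, hk⟩ := hin
        rw [← h', ← iterate_add_apply] at hk
        exact iterate_ne_of_minimalPeriod_eq_zero h0 (by omega) hk
  · rw [← eventually_walk (h.trans hrev)]
    refine ⟨1, fun j hj => ?_⟩
    simp only [mem_ofPred_eq, hin, iff_false]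
    induction j, hj using Nat.le_induction with
    | base => exact hR.walk_rev_notMem he
    | succ j hj ih =>
      rw [iterate_succ_apply', hR.walk_mem_iff he (hrev.trans (sameCycle_iterate _ _ _)) ?_
        (iterate_ne_of_minimalPeriod_eq_zero ((minimalPeriod_eq_of_sameCycle hrev).trans h0) hj)]
      · exact ih
      · intro h'
        refine hin ⟨j - 1, ?_⟩
        rw [Nat.sub_add_cancel hj, h']

/-- The left side is contained in the finite stretch of the walk after −e up to and including e:
this stretch together with the right side is stable under the walk. -/
lemma finite_left_of_inward (he : M.emark e ≠ true) (hin : M.Inward e) :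
    {x | M.walk.SameCycle e x ∧ x ∉ R e}.Finite := by
  obtain ⟨k, hk⟩ := hin
  refine ((finite_Iic k).image fun j => M.walk^[j + 1] (M.rev e)).subset ?_
  rintro x ⟨hx, hxR⟩
  refine Or.resolve_right ((mem_iff_of_sameCycle (Z := {x |
    x ∈ (fun j => M.walk^[j + 1] (M.rev e)) '' Iic k ∨ x ∈ R e}) hx fun y hy => ⟨?_, ?_⟩).2
    (Or.inl ⟨k, mem_Iic.2 le_rfl, hk⟩)) hxR
  · rintro (⟨j, hj, hjy⟩ | h)
    · simp only [iterate_succ_apply'] at hjy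
      have hjy := M.walk.injective hjy
      rcases j with _ | j
      · right
        rw [← hjy]
        exact hR.rev_mem e he
      · exact Or.inl ⟨j, (Nat.le_succ j).trans hj, hjy⟩
    · by_cases h1 : y = e
      · exact Or.inl ⟨k, mem_Iic.2 le_rfl, h1 ▸ hk⟩
      by_cases h2 : y = M.rev e
      · exact absurd (h2 ▸ h) (hR.walk_rev_notMem he)
      exact Or.inr ((hR.walk_mem_iff he hy h1 h2).1 h)
  · rintro (⟨j, hj, rfl⟩ | h)
    · rcases eq_or_lt_of_le (mem_Iic.1 hj) with rfl | hj
      · right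
        simp only [hk]
        exact hR.walk_self_mem he
      · exact Or.inl ⟨j + 1, hj, by simp only [iterate_succ_apply']⟩
    · by_cases h1 : y = e
      · exact absurd (h1 ▸ h) (hR.notMem e he)
      by_cases h2 : y = M.rev e
      · exact Or.inl ⟨0, mem_Iic.2 k.zero_le, by simp [h2]⟩
      exact Or.inr ((hR.walk_mem_iff he hy h1 h2).2 h)

/-- The shares of the sides of an infinite face vanish. -/
theorem share_eq_zero (h : minimalPeriod M.dualPerm e = 0) : M.share e = 0 := by
  have hinf : ¬ {x | M.dualPerm.SameCycle e x}.Finite := by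
    rw [finite_orbit_iff]; simpa using h
  by_cases h0 : minimalPeriod M.walk e = 0
  · rw [share, if_pos h0, if_neg]
    rintro ⟨he, hin⟩
    -- The infinite face of M lies on the left of e, where an inward edge has only finitely many
    -- oriented edges.
    exact hinf ((hR.finite_left_of_inward he hin).subset fun x hx =>
      ⟨hR.sameCycle_of_face hx, hR.mem_iff_of_face he hx⟩)
  · exact absurd ((finite_orbit_iff.2 h0).subset fun x hx => hR.sameCycle_of_face hx) hinf

/-- The shares of the sides of a finite face add up to one. -/
theorem sum_share (h : minimalPeriod M.dualPerm e ≠ 0) :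
    ∑ k ∈ Finset.range (minimalPeriod M.dualPerm e), M.share (M.dualPerm^[k] e) = 1 := by
  classical
  have hw : ∀ k, M.walk.SameCycle e (M.dualPerm^[k] e) := fun k =>
    hR.sameCycle_of_face (sameCycle_iterate _ _ _)
  by_cases h0 : minimalPeriod M.walk e = 0
  · have h1 : ∀ k, ∃ J, ∀ j ≥ J, M.walk^[j] e ≠ M.dualPerm^[k] e := fun k =>
      eventually_ne ((minimalPeriod_eq_of_sameCycle (hw k)).trans h0) (hw k)
    have h2 : ∀ k, ∃ J, ∀ j ≥ J, M.emark (M.dualPerm^[k] e) ≠ true →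
        (M.walk^[j] e ∈ R (M.dualPerm^[k] e) ↔ M.Inward (M.dualPerm^[k] e)) := by
      intro k
      by_cases hk : M.emark (M.dualPerm^[k] e) = true
      · exact ⟨0, fun j _ h' => absurd hk h'⟩
      · obtain ⟨J, hJ⟩ := hR.eventually_mem_iff hk
          ((minimalPeriod_eq_of_sameCycle (hw k)).trans h0) (hw k)
        exact ⟨J, fun j hj _ => hJ j hj⟩
    choose J₁ hJ₁ using h1
    choose J₂ hJ₂ using h2
    let n := minimalPeriod M.dualPerm e
    -- The oriented edge J steps along the walk stands in for infinity. It is none of the finitely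
    -- many sides of the face, and it is to the right of a closed side exactly when that side is
    -- inward.
    let J := (Finset.range n).sup J₁ + (Finset.range n).sup J₂
    have hu := sum_orbit_ite_eq_one (A := ℝ≥0∞) h (p := fun x => M.walk^[J] e = x ∨
      (M.emark x ≠ true ∧ M.walk^[J] e ∈ R x)) (hR.existsUnique_toward (sameCycle_iterate _ _ _))
    refine Eq.trans (Finset.sum_congr rfl fun k hk => ?_) hu
    rw [share, if_pos ((minimalPeriod_eq_of_sameCycle (hw k)).trans h0)]
    refine if_congr ?_ rfl rfl
    have hk1 : J₁ k ≤ J := (Finset.le_sup hk).trans (Nat.le_add_right _ _)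
    have hk2 : J₂ k ≤ J := (Finset.le_sup hk).trans (Nat.le_add_left _ _)
    simp only [hJ₁ k J hk1, false_or]
    exact and_congr_right fun he => (hJ₂ k J hk2 he).symm
  · have hshare : ∀ k, M.share (M.dualPerm^[k] e) =
        (∑ j ∈ Finset.range (minimalPeriod M.walk e), if M.emark (M.walk^[j] e) = true ∧
          (M.walk^[j] e = M.dualPerm^[k] e ∨ (M.emark (M.dualPerm^[k] e) ≠ true ∧
            M.walk^[j] e ∈ R (M.dualPerm^[k] e))) then 1 else 0) / M.openCount e := by
      intro k
      rw [hR.share_of_ne_zero ((minimalPeriod_eq_of_sameCycle (hw k)).trans_ne h0),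
        openCount_eq_of_sameCycle (hw k)]
      congr 1
      exact sum_orbit_eq (hw k) (fun x => if M.emark x = true ∧ (x = M.dualPerm^[k] e ∨
        (M.emark (M.dualPerm^[k] e) ≠ true ∧ x ∈ R (M.dualPerm^[k] e))) then (1 : ℝ≥0∞) else 0)
    simp only [hshare, div_eq_mul_inv]
    -- Double counting: each open oriented edge of the orbit is counted by exactly one side of the
    -- face of M.
    rw [← Finset.sum_mul, Finset.sum_comm, ← div_eq_mul_inv,
      ENNReal.div_eq_one_iff (hR.openCount_ne_zero h0) (openCount_ne_top e), openCount]
    refine Finset.sum_congr rfl fun j _ => ?_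
    by_cases hj : M.emark (M.walk^[j] e) = true
    · simp only [hj, true_and, if_true]
      exact sum_orbit_ite_eq_one (A := ℝ≥0∞) h (p := fun x => M.walk^[j] e = x ∨
        (M.emark x ≠ true ∧ M.walk^[j] e ∈ R x))
        (hR.existsUnique_toward (sameCycle_iterate _ _ _))
    · simp [hj]

end HasSides
end MarkedMap

namespace MarkedMap
open Function

/-! ### The sides of the edges in the faces of a submap -/

section submap
variable {M : MarkedMap Bool} {ρ : M.V}

lemma mem_cluster_darts (hv : (M.cluster ρ).verts = univ) (e : M.D) :
    e ∈ (M.cluster ρ).darts ↔ M.emark e = true :=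
  ⟨fun h => h.1, fun h => ⟨h, hv.ge (mem_univ (M.tail e))⟩⟩

lemma dualPerm_apply {X : Type} {M : MarkedMap X} (e : M.D) :
    M.dualPerm e = M.σ.symm (M.rev e) := rfl

/-- At a closed oriented edge the walk is just a clockwise turn, which in n steps leads back to e
unless an open edge is met earlier. -/
lemma exists_open_of_pow {e : M.D} (he : M.emark e = true) (n : ℕ) :
    ∃ k, M.emark (M.walk^[k] ((M.σ ^ n) e)) = true := by
  induction n with
  | zero => exact ⟨0, he⟩
  | succ n ih =>
    by_cases h : M.emark ((M.σ ^ (n + 1)) e) = true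
    · exact ⟨0, h⟩
    · obtain ⟨k, hk⟩ := ih
      refine ⟨k + 1, ?_⟩
      rwa [iterate_succ_apply, walk_of_closed h, dualPerm_apply, M.rev_rev, pow_succ',
        Equiv.Perm.mul_apply, Equiv.symm_apply_apply]

variable (hv : (M.cluster ρ).verts = univ)
include hv

/-- One step around a face of the cluster unfolds into several steps of the walk: one along the open
edge, then one clockwise turn past each closed oriented edge skipped by the induced rotation. -/
lemma walk_sameCycle_toMap_dual (h : (M.cluster ρ).toMap.D) :
    M.walk.SameCycle h.1 ((M.cluster ρ).toMap.dualPerm h).1 := by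
  classical
  let F := (M.cluster ρ).darts
  let h' : F := (M.cluster ρ).toMap.dualPerm h
  have h1 : M.nextIn F h' = ⟨M.rev h.1, (M.cluster ρ).rev_mem _ h.2⟩ :=
    (M.inducedσ F).apply_symm_apply _
  have h2 := congrArg Subtype.val h1
  simp only [nextIn] at h2
  set n := Nat.find (M.exists_return F h') with hn
  have h3 : ∀ m ≤ n, M.walk.SameCycle ((M.σ ^ m) h'.1) h'.1 := by
    intro m
    induction m with
    | zero => exact fun _ => .refl _ _
    | succ m ih =>
      intro hm
      have hcl : M.emark ((M.σ ^ (m + 1)) h'.1) ≠ true := fun h4 =>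
        Nat.find_min (M.exists_return F h') (m := m) (by omega)
          ((mem_cluster_darts hv _).2 h4)
      have := sameCycle_step M.walk ((M.σ ^ (m + 1)) h'.1)
      rw [walk_of_closed hcl, dualPerm_apply, M.rev_rev, pow_succ', Equiv.Perm.mul_apply,
        Equiv.symm_apply_apply] at this
      rw [pow_succ', Equiv.Perm.mul_apply]
      exact this.trans (ih (by omega))
  have h4 : M.walk h.1 = (M.σ ^ n) h'.1 := by
    rw [walk_of_open ((mem_cluster_darts hv _).1 h.2), dualPerm_apply, ← h2, pow_succ',
      Equiv.Perm.mul_apply, Equiv.symm_apply_apply]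
  exact (sameCycle_step M.walk h.1).trans (h4 ▸ h3 n le_rfl)

lemma faceOf_walk (a : M.D) : (M.cluster ρ).faceOf (M.walk a) = (M.cluster ρ).faceOf a := by
  by_cases h : M.emark a = true
  · rw [walk_of_open h, Sub.faceOf_dualPerm hv]
  · rw [walk_of_closed h, Sub.faceOf_dualPerm hv,
      Sub.faceOf_rev hv (mt (mem_cluster_darts hv a).1 h)]

lemma faceOf_eq_of_sameCycle {a b : M.D} (h : M.walk.SameCycle a b) :
    (M.cluster ρ).faceOf b = (M.cluster ρ).faceOf a :=
  (mem_iff_of_sameCycle (Z := {x | (M.cluster ρ).faceOf x = (M.cluster ρ).faceOf a}) h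
    fun x _ => by simp only [mem_ofPred_eq, faceOf_walk hv]).2 rfl

lemma walk_sameCycle_of_toMap {h h' : (M.cluster ρ).toMap.D}
    (hh : (M.cluster ρ).toMap.dualPerm.SameCycle h h') : M.walk.SameCycle h.1 h'.1 :=
  (mem_iff_of_sameCycle
    (Z := {x : (M.cluster ρ).toMap.D | M.walk.SameCycle h.1 (x : (M.cluster ρ).darts).1}) hh
    fun x _ => ⟨fun h => h.trans (walk_sameCycle_toMap_dual hv x).symm,
      fun h => h.trans (walk_sameCycle_toMap_dual hv x)⟩).2 (Equiv.Perm.SameCycle.refl M.walk h.1)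

variable (hsub : (M.cluster ρ).IsSubmap)
include hsub

/-- The single-orbit condition enters here: a face of the cluster has only one boundary orbit. -/
lemma toMap_sameCycle_of_faceOf {h h' : (M.cluster ρ).toMap.D}
    (hh : (M.cluster ρ).faceOf h.1 = (M.cluster ρ).faceOf h'.1) :
    (M.cluster ρ).toMap.dualPerm.SameCycle h h' := by
  obtain ⟨e₀, he₀⟩ := hsub.single_orbit _ (Sub.faceOf_mem_faces hv h.1)
  have h1 : h ∈ (M.cluster ρ).toMap.face e₀ :=
    he₀.le ((Sub.leftPoint_mem_faceOf hv _ _).2 rfl)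
  have h2 : h' ∈ (M.cluster ρ).toMap.face e₀ :=
    he₀.le ((Sub.leftPoint_mem_faceOf hv _ _).2 hh.symm)
  exact h1.symm.trans h2

/-- The single-orbit condition provides some open edge. An open path towards its tail either has a
first edge, which starts at the given vertex, or is trivial. -/
lemma exists_open_star (a : M.D) : ∃ e, M.emark e = true ∧ M.tail e = M.tail a := by
  obtain ⟨e₀, -⟩ := hsub.single_orbit _ (Sub.faceOf_mem_faces hv a)
  have hc := (M.cluster ρ).connected (M.tail a) (hv.ge (mem_univ _)) (M.tail e₀.1)
    (hv.ge (mem_univ _))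
  rcases hc.cases_head with h | ⟨c, ⟨e, he, h1, -⟩, -⟩
  · exact ⟨e₀.1, e₀.2.1, h.symm⟩
  · exact ⟨e, he.1, h1⟩

lemma exists_open_walk (a : M.D) : ∃ k, M.emark (M.walk^[k] a) = true := by
  obtain ⟨e, he, h1⟩ := exists_open_star hv hsub a
  obtain ⟨n, rfl⟩ := M.exists_pow h1
  exact exists_open_of_pow he n

/-- The walk never leaves a face of the cluster. Conversely, from each of the two oriented edges it
reaches an open one, and the open ones of a face lie in one orbit. -/
lemma faceOf_eq_iff {a b : M.D} :
    (M.cluster ρ).faceOf a = (M.cluster ρ).faceOf b ↔ M.walk.SameCycle a b := by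
  refine ⟨fun h => ?_, fun h => (faceOf_eq_of_sameCycle hv h).symm⟩
  obtain ⟨k, hk⟩ := exists_open_walk hv hsub a
  obtain ⟨l, hl⟩ := exists_open_walk hv hsub b
  have hk' := sameCycle_iterate M.walk a k
  have hl' := sameCycle_iterate M.walk b l
  refine hk'.trans (Equiv.Perm.SameCycle.trans ?_ hl'.symm)
  refine walk_sameCycle_of_toMap hv (h := ⟨_, (mem_cluster_darts hv _).2 hk⟩)
    (h' := ⟨_, (mem_cluster_darts hv _).2 hl⟩) (toMap_sameCycle_of_faceOf hv hsub ?_)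
  change (M.cluster ρ).faceOf (M.walk^[k] a) = (M.cluster ρ).faceOf (M.walk^[l] b)
  rw [faceOf_eq_of_sameCycle hv hk', faceOf_eq_of_sameCycle hv hl', h]

theorem exists_hasSides : ∃ R, M.HasSides R := by
  have hmem := mem_cluster_darts hv
  have key : ∀ e, ∃ R : Set M.D, M.emark e ≠ true → (e ∉ R ∧ M.rev e ∈ R ∧
      (∀ a, (M.cluster ρ).faceOf a = (M.cluster ρ).faceOf e → (M.dualPerm a ∈ R ↔ a ∈ R)) ∧
      ∀ a, (M.cluster ρ).faceOf a = (M.cluster ρ).faceOf e → a ∉ (M.cluster ρ).darts → a ≠ e →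
        a ≠ M.rev e → (M.rev a ∈ R ↔ a ∈ R)) := by
    intro e
    by_cases he : M.emark e = true
    · exact ⟨∅, fun h => absurd he h⟩
    · obtain ⟨R, hR⟩ := Sub.exists_right_side hv hsub (mt (hmem e).1 he)
      exact ⟨R, fun _ => hR⟩
  choose R hR using key
  refine ⟨R, exists_open_walk hv hsub, fun a => ?_, fun a ha => ?_, fun e he => (hR e he).1,
    fun e he => (hR e he).2.1, fun e he a ha => (hR e he).2.2.1 a ?_,
    fun e he a ha h1 => (hR e he).2.2.2 a ?_ (mt (hmem a).1 h1)⟩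
  · exact (faceOf_eq_iff hv hsub).1 (Sub.faceOf_dualPerm hv a).symm
  · exact (faceOf_eq_iff hv hsub).1 (Sub.faceOf_rev hv (mt (hmem a).1 ha)).symm
  · exact faceOf_eq_of_sameCycle hv ha
  · exact faceOf_eq_of_sameCycle hv ha

lemma image_toMap_face (h : (M.cluster ρ).toMap.D) :
    (Subtype.val '' ((M.cluster ρ).toMap.face h : Set (M.cluster ρ).darts) : Set M.D) =
      {x | M.walk.SameCycle h.1 x ∧ M.emark x = true} := by
  ext x
  constructor
  · rintro ⟨h', hh', rfl⟩
    exact ⟨walk_sameCycle_of_toMap hv hh', (mem_cluster_darts hv _).1 h'.2⟩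
  · rintro ⟨h1, h2⟩
    exact ⟨⟨x, (mem_cluster_darts hv _).2 h2⟩,
      toMap_sameCycle_of_faceOf hv hsub (faceOf_eq_of_sameCycle hv h1).symm, rfl⟩

end submap

/-! ### Curvature in terms of the inverse face degrees -/

section curvature
variable {M : MarkedMap Bool}

/-- The sum of a function over the oriented edges emanating from `v`. -/
def starSum {X : Type} (M : MarkedMap X) (v : M.V) (φ : M.D → ℝ≥0∞) : ℝ≥0∞ :=
  ∑ e ∈ (M.finite_star v).toFinset, φ e

lemma faceInv_le_one (e : M.D) : M.faceInv e ≤ 1 := by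
  rw [faceInv]
  split_ifs with h
  · exact zero_le_one
  · rw [ENNReal.inv_le_one]
    exact_mod_cast Nat.one_le_iff_ne_zero.2 h

/-- Since (d − 2)/d·π = π − 2π/d, the value 0 of `faceInv` on infinite faces yields the angle π
prescribed there. -/
lemma cornerAngle_eq (e : M.D) :
    M.cornerAngle e = Real.pi - 2 * Real.pi * (M.faceInv e).toReal := by
  have hfin : (M.face e).Finite ↔ minimalPeriod M.dualPerm e ≠ 0 := finite_orbit_iff
  rw [cornerAngle, faceInv]
  by_cases h : minimalPeriod M.dualPerm e = 0
  · simp [h, hfin]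
  · rw [if_pos (hfin.2 h), if_neg h, show (M.face e).ncard = _ from ncard_orbit h]
    have : ((minimalPeriod M.dualPerm e : ℕ) : ℝ) ≠ 0 := by exact_mod_cast h
    rw [ENNReal.toReal_inv, ENNReal.toReal_natCast]
    field_simp

lemma curvature_eq (v : M.V) : M.forget.curvature v = 2 * Real.pi -
    Real.pi * (M.starSum v fun _ => 1).toReal +
      2 * Real.pi * (M.starSum v M.faceInv).toReal := by
  have h1 : M.forget.curvature v = 2 * Real.pi - ∑ᶠ e ∈ {e | M.tail e = v}, M.cornerAngle e := rfl
  rw [h1, finsum_mem_eq_finite_toFinset_sum _ (M.finite_star v), starSum, starSum,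
    ENNReal.toReal_sum (by simp), ENNReal.toReal_sum
      (fun e _ => ((faceInv_le_one e).trans_lt ENNReal.one_lt_top).ne), Finset.mul_sum,
    Finset.mul_sum, sub_add, ← Finset.sum_sub_distrib]
  simp only [cornerAngle_eq, ENNReal.toReal_one, mul_one]

lemma degree_eq (v : M.V) : ((M.forget.degree v : ℕ) : ℝ≥0∞) = M.starSum v fun _ => 1 := by
  have h1 : M.forget.degree v = {e | M.tail e = v}.ncard := rfl
  rw [h1, starSum, Finset.sum_const, nsmul_eq_mul, mul_one,
    ncard_eq_toFinset_card _ (M.finite_star v)]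

variable {R : M.D → Set M.D}

lemma HasSides.openFaceInv_le_one (hR : M.HasSides R) (e : M.D) : M.openFaceInv e ≤ 1 := by
  rw [openFaceInv]
  split_ifs with h
  · exact zero_le_one
  · have := hR.openCount_ne_zero h
    rw [openCount, Finset.sum_boole] at this ⊢
    rw [ENNReal.inv_le_one]
    exact_mod_cast Nat.one_le_iff_ne_zero.2 (by exact_mod_cast this)

/-- An infinite walk leaves every finite set for good, yet it always meets another open edge. So an
infinite orbit of the walk gives a face of infinite degree in the cluster. -/
lemma HasSides.infinite_open (hR : M.HasSides R) {e : M.D} (h0 : minimalPeriod M.walk e = 0) :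
    {x | M.walk.SameCycle e x ∧ M.emark x = true}.Infinite := by
  intro hfin
  have h1 : ∀ᶠ j in Filter.atTop, ∀ x ∈ {x | M.walk.SameCycle e x ∧ M.emark x = true},
      M.walk^[j] e ≠ x := by
    rw [Filter.eventually_all_finite hfin]
    intro x hx
    rw [Filter.eventually_atTop]
    exact eventually_ne ((minimalPeriod_eq_of_sameCycle hx.1).trans h0) hx.1
  obtain ⟨J, hJ⟩ := Filter.eventually_atTop.1 h1
  obtain ⟨k, hk⟩ := hR.exists_open (M.walk^[J] e)
  rw [← iterate_add_apply] at hk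
  exact hJ (k + J) (by omega) _ ⟨sameCycle_iterate _ _ _, hk⟩ rfl

lemma ncard_open {e : M.D} (h0 : minimalPeriod M.walk e ≠ 0) :
    (({x | M.walk.SameCycle e x ∧ M.emark x = true}.ncard : ℕ) : ℝ≥0∞) = M.openCount e := by
  have : {x | M.walk.SameCycle e x ∧ M.emark x = true} = (fun k => M.walk^[k] e) ''
      ((Finset.range (minimalPeriod M.walk e)).filter
        fun k => M.emark (M.walk^[k] e) = true : Finset ℕ) := by
    ext x
    constructor
    · rintro ⟨h1, h2⟩
      obtain ⟨k, hk, rfl⟩ := exists_iterate_of_sameCycle h0 h1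
      exact ⟨k, by simp [hk, h2], rfl⟩
    · rintro ⟨k, hk, rfl⟩
      simp only [Finset.coe_filter, mem_ofPred_eq] at hk
      exact ⟨sameCycle_iterate _ _ _, hk.2⟩
  rw [this, InjOn.ncard_image, ncard_coe_finset, openCount, Finset.sum_boole]
  exact (iterate_injOn e).mono fun k hk => by
    simp only [Finset.coe_filter, mem_ofPred_eq, Finset.mem_range] at hk
    exact hk.1

variable {ρ : M.V} (hv : (M.cluster ρ).verts = univ) (hsub : (M.cluster ρ).IsSubmap)
include hv hsub

lemma toMap_cornerAngle_eq (h : (M.cluster ρ).toMap.D) : (M.cluster ρ).toMap.cornerAngle h =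
    Real.pi - 2 * Real.pi * (M.openFaceInv h.1).toReal := by
  obtain ⟨R, hR⟩ := exists_hasSides hv hsub
  have himg := image_toMap_face hv hsub h
  have hinj : InjOn Subtype.val ((M.cluster ρ).toMap.face h : Set (M.cluster ρ).darts) :=
    Subtype.val_injective.injOn
  have hfin : ((M.cluster ρ).toMap.face h).Finite ↔ minimalPeriod M.walk h.1 ≠ 0 := by
    refine (finite_image_iff hinj).symm.trans ?_
    rw [himg]
    exact ⟨fun h1 h0 => hR.infinite_open h0 h1,
      fun h0 => (finite_orbit_iff.2 h0).subset fun x hx => hx.1⟩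
  rw [cornerAngle, openFaceInv]
  by_cases h0 : minimalPeriod M.walk h.1 = 0
  · simp [h0, hfin]
  · have hn : ((((M.cluster ρ).toMap.face h).ncard : ℕ) : ℝ≥0∞) = M.openCount h.1 := by
      rw [← ncard_open h0, ← himg]
      congr 1
      exact hinj.ncard_image.symm
    rw [if_pos (hfin.2 h0), if_neg h0, ← hn, ENNReal.toReal_inv, ENNReal.toReal_natCast]
    have : (((M.cluster ρ).toMap.face h).ncard : ℝ) ≠ 0 := by
      have := hR.openCount_ne_zero h0
      rw [← hn] at this
      exact_mod_cast this
    field_simp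

lemma cluster_curvature_eq : (M.cluster ρ).toMap.forget.curvature ⟨ρ, .refl⟩ = 2 * Real.pi -
    Real.pi * (M.starSum ρ fun e => if M.emark e = true then 1 else 0).toReal +
      2 * Real.pi *
        (M.starSum ρ fun e => if M.emark e = true then M.openFaceInv e else 0).toReal := by
  obtain ⟨R, hR⟩ := exists_hasSides hv hsub
  have h1 : (M.cluster ρ).toMap.forget.curvature ⟨ρ, .refl⟩ = 2 * Real.pi -
      ∑ᶠ e ∈ {e : (M.cluster ρ).toMap.D | (M.cluster ρ).toMap.tail e = ⟨ρ, .refl⟩},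
        (M.cluster ρ).toMap.cornerAngle e := rfl
  let g : M.D → ℝ := fun e => Real.pi - 2 * Real.pi * (M.openFaceInv e).toReal
  have h2 : ∑ᶠ e ∈ {e : (M.cluster ρ).toMap.D | (M.cluster ρ).toMap.tail e = ⟨ρ, .refl⟩},
      (M.cluster ρ).toMap.cornerAngle e =
      ∑ᶠ e ∈ {e | M.tail e = ρ ∧ M.emark e = true}, g e := by
    simp only [toMap_cornerAngle_eq hv hsub]
    have himg : {e | M.tail e = ρ ∧ M.emark e = true} = Subtype.val ''
        {e : (M.cluster ρ).darts | (M.cluster ρ).toMap.tail e = ⟨ρ, .refl⟩} := by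
      ext e
      constructor
      · rintro ⟨h3, h4⟩
        exact ⟨⟨e, (mem_cluster_darts hv _).2 h4⟩, Subtype.ext h3, rfl⟩
      · rintro ⟨e, he, rfl⟩
        exact ⟨congrArg Subtype.val he, (mem_cluster_darts hv _).1 e.2⟩
    rw [himg, finsum_mem_image Subtype.val_injective.injOn]
    rfl
  have hset : {e | M.tail e = ρ ∧ M.emark e = true} =
      ((M.finite_star ρ).toFinset.filter fun e => M.emark e = true : Finset M.D) := by
    ext e; simp
  rw [h1, h2, hset, finsum_mem_coe_finset, Finset.sum_filter, starSum, starSum,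
    ENNReal.toReal_sum (fun e _ => by split_ifs <;> simp), ENNReal.toReal_sum
      (fun e _ => ?_), Finset.mul_sum,
    Finset.mul_sum, sub_add, ← Finset.sum_sub_distrib]
  · congr 1
    refine Finset.sum_congr rfl fun e _ => ?_
    by_cases he : M.emark e = true <;> simp [he, g]
  · split_ifs
    · exact ((hR.openFaceInv_le_one e).trans_lt ENNReal.one_lt_top).ne
    · simp

end curvature
end MarkedMap

section
open Function MarkedMap

/-! ### Maps rooted at an oriented edge -/

/-- A percolated map with a distinguished oriented edge. -/
structure DartRooted where
  map : MarkedMap Bool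
  dart : map.D

namespace MarkedMap

/-- The two elementary moves on oriented edges: reversal and clockwise rotation. -/
def step (M : MarkedMap Bool) : Bool → M.D → M.D
  | true, e => M.rev e
  | false, e => M.σ.symm e

/-- The oriented edge that is reached by a sequence of elementary moves. -/
def act (M : MarkedMap Bool) : List Bool → M.D → M.D
  | [], e => e
  | b :: w, e => act M w (M.step b e)

lemma act_append (M : MarkedMap Bool) (w w' : List Bool) (e : M.D) :
    M.act (w ++ w') e = M.act w' (M.act w e) := by
  induction w generalizing e with
  | nil => rfl
  | cons b w ih => exact ih _

end MarkedMap

namespace DartRooted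

/-- The surroundings of the roots agree, as far as they are seen by at most `n` moves. -/
def CodeAgree (n : ℕ) (x y : DartRooted) : Prop :=
  ∀ w w' : List Bool, w.length ≤ n → w'.length ≤ n →
    (x.map.act w x.dart = x.map.act w' x.dart ↔ y.map.act w y.dart = y.map.act w' y.dart) ∧
    x.map.emark (x.map.act w x.dart) = y.map.emark (y.map.act w y.dart)

/-- A set of maps rooted at an oriented edge is local if it is determined by what is seen from the
root in at most `n` moves. -/
def IsLocal (n : ℕ) (A : Set DartRooted) : Prop := ∀ x y, CodeAgree n x y → (x ∈ A ↔ y ∈ A)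

/-- Local sets are stable under finite intersections, so a π-λ argument can later reduce
measurability to indicators of local sets. -/
instance : MeasurableSpace DartRooted := .generateFrom {A | ∃ n, IsLocal n A}

lemma CodeAgree.mono {m n : ℕ} (h : m ≤ n) {x y : DartRooted} (hxy : CodeAgree n x y) :
    CodeAgree m x y := fun w w' hw hw' => hxy w w' (hw.trans h) (hw'.trans h)

lemma CodeAgree.shift {n : ℕ} {w : List Bool} {x y : DartRooted}
    (hxy : CodeAgree (w.length + n) x y) :
    CodeAgree n ⟨x.map, x.map.act w x.dart⟩ ⟨y.map, y.map.act w y.dart⟩ := by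
  intro u u' hu hu'
  have := hxy (w ++ u) (w ++ u') (by simp [hu]) (by simp [hu'])
  simpa only [act_append] using this

lemma IsLocal.measurableSet {n : ℕ} {A : Set DartRooted} (h : IsLocal n A) : MeasurableSet A :=
  MeasurableSpace.measurableSet_generateFrom ⟨n, h⟩

lemma isPiSystem_isLocal : IsPiSystem {A | ∃ n, IsLocal n A} := by
  rintro A ⟨m, hA⟩ B ⟨n, hB⟩ -
  exact ⟨max m n, fun x y hxy => and_congr (hA x y (hxy.mono (le_max_left _ _)))
    (hB x y (hxy.mono (le_max_right _ _)))⟩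

/-- An operation on oriented edges that makes a bounded number of moves, depending on the
surroundings. -/
def IsLocalOp (T : ∀ M : MarkedMap Bool, M.D → M.D) : Prop :=
  ∃ m, ∀ x y : DartRooted, CodeAgree m x y → ∃ w : List Bool, w.length ≤ m ∧
    T x.map x.dart = x.map.act w x.dart ∧ T y.map y.dart = y.map.act w y.dart

variable {S T : ∀ M : MarkedMap Bool, M.D → M.D}

lemma isLocalOp_id : IsLocalOp fun _ e => e := ⟨0, fun _ _ _ => ⟨[], le_rfl, rfl, rfl⟩⟩

lemma isLocalOp_rev : IsLocalOp fun M e => M.rev e :=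
  ⟨1, fun _ _ _ => ⟨[true], le_rfl, rfl, rfl⟩⟩

lemma isLocalOp_σ_symm : IsLocalOp fun M e => M.σ.symm e :=
  ⟨1, fun _ _ _ => ⟨[false], le_rfl, rfl, rfl⟩⟩

lemma IsLocalOp.comp (hT : IsLocalOp T) (hS : IsLocalOp S) :
    IsLocalOp fun M e => T M (S M e) := by
  obtain ⟨m, hT⟩ := hT
  obtain ⟨n, hS⟩ := hS
  refine ⟨n + m, fun x y hxy => ?_⟩
  obtain ⟨w, hw, h1, h2⟩ := hS x y (hxy.mono (by omega))
  obtain ⟨w', hw', h3, h4⟩ := hT _ _ (CodeAgree.shift (w := w) (hxy.mono (by omega : _ ≤ n + m)))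
  refine ⟨w ++ w', by simp; omega, ?_, ?_⟩
  · exact (congrArg (T x.map) h1).trans (h3.trans (act_append _ _ _ _).symm)
  · exact (congrArg (T y.map) h2).trans (h4.trans (act_append _ _ _ _).symm)

lemma IsLocalOp.iterate (hT : IsLocalOp T) (k : ℕ) : IsLocalOp fun M => (T M)^[k] := by
  induction k with
  | zero => exact isLocalOp_id
  | succ k ih => exact ih.comp hT

lemma isLocalOp_dualPerm : IsLocalOp fun M => M.dualPerm := isLocalOp_σ_symm.comp isLocalOp_rev

/-- The word of moves depends on whether the root edge is open; `IsLocalOp` permits this dependence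
for the sake of the walk. -/
lemma isLocalOp_walk : IsLocalOp fun M => M.walk := by
  refine ⟨2, fun x y hxy => ?_⟩
  have h := (hxy [] [] (by simp) (by simp)).2
  change x.map.emark x.dart = y.map.emark y.dart at h
  by_cases hx : x.map.emark x.dart = true
  · exact ⟨[true, false], le_rfl, walk_of_open hx, walk_of_open (h ▸ hx)⟩
  · have hw : ∀ x : DartRooted, x.map.emark x.dart ≠ true →
        x.map.walk x.dart = x.map.σ.symm x.dart := fun x hx => by
      rw [walk_of_closed hx, dualPerm_apply, x.map.rev_rev]
    exact ⟨[false], by simp, hw x hx, hw y (h ▸ hx)⟩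

lemma IsLocalOp.measurable (hT : IsLocalOp T) :
    Measurable fun x : DartRooted => (⟨x.map, T x.map x.dart⟩ : DartRooted) := by
  obtain ⟨m, hT⟩ := hT
  refine measurable_generateFrom ?_
  rintro A ⟨n, hA⟩
  refine IsLocal.measurableSet (n := m + n) fun x y hxy => ?_
  obtain ⟨w, hw, h1, h2⟩ := hT x y (hxy.mono (by omega))
  rw [mem_preimage, mem_preimage, h1, h2]
  exact hA _ _ (CodeAgree.shift (hxy.mono (by omega)))

lemma IsLocalOp.measurableSet_eq (hT : IsLocalOp T) (hS : IsLocalOp S) :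
    MeasurableSet {x : DartRooted | T x.map x.dart = S x.map x.dart} := by
  obtain ⟨m, hT⟩ := hT
  obtain ⟨n, hS⟩ := hS
  refine IsLocal.measurableSet (n := m + n) fun x y hxy => ?_
  obtain ⟨w, hw, h1, h2⟩ := hT x y (hxy.mono (by omega))
  obtain ⟨w', hw', h3, h4⟩ := hS x y (hxy.mono (by omega))
  rw [mem_ofPred_eq, mem_ofPred_eq, h1, h2, h3, h4]
  exact (hxy w w' (by omega) (by omega)).1

lemma measurableSet_open : MeasurableSet {x : DartRooted | x.map.emark x.dart = true} :=
  IsLocal.measurableSet (n := 0) fun x y hxy => by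
    have h := (hxy [] [] (by simp) (by simp)).2
    change x.map.emark x.dart = y.map.emark y.dart at h
    rw [mem_ofPred_eq, mem_ofPred_eq, h]

lemma IsLocalOp.measurable_minimalPeriod (hT : IsLocalOp T) :
    Measurable fun x : DartRooted => minimalPeriod (T x.map) x.dart := by
  refine measurable_to_countable' fun n => ?_
  have : (fun x : DartRooted => minimalPeriod (T x.map) x.dart) ⁻¹' {n} =
      ⋂ k, {x : DartRooted | (T x.map)^[k] x.dart = x.dart ↔ n ∣ k} := by
    ext x
    simp only [mem_preimage, mem_singleton_iff, mem_iInter, mem_ofPred_eq]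
    -- A natural number is determined by its multiples. This includes the period 0 of infinite
    -- orbits.
    rw [← Nat.dvd_right_iff_eq]
    exact forall_congr' fun k => by rw [← isPeriodicPt_iff_minimalPeriod_dvd]; rfl
  rw [this]
  refine MeasurableSet.iInter fun k => ?_
  have hm := (hT.iterate k).measurableSet_eq isLocalOp_id
  by_cases hk : n ∣ k
  · simpa only [hk, iff_true] using hm
  · simp only [hk, iff_false]
    exact hm.compl

lemma measurable_sum_range {α : Type*} [MeasurableSpace α] {N : α → ℕ} (hN : Measurable N)
    {g : ℕ → α → ℝ≥0∞} (hg : ∀ k, Measurable (g k)) :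
    Measurable fun x => ∑ k ∈ Finset.range (N x), g k x := by
  have : (fun x => ∑ k ∈ Finset.range (N x), g k x) =
      fun x => ∑' k, if k < N x then g k x else 0 := by
    funext x
    rw [tsum_eq_sum (s := Finset.range (N x)) (fun k hk => if_neg (by simpa using hk))]
    exact Finset.sum_congr rfl fun k hk => (if_pos (by simpa using hk)).symm
  rw [this]
  exact Measurable.tsum fun k =>
    Measurable.ite (measurableSet_lt measurable_const hN) (hg k) measurable_const

lemma measurable_faceInv : Measurable fun x : DartRooted => x.map.faceInv x.dart := by
  have hN := isLocalOp_dualPerm.measurable_minimalPeriod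
  refine Measurable.ite (hN (measurableSet_singleton 0)) measurable_const ?_
  exact ((measurable_from_top (f := fun n : ℕ => (n : ℝ≥0∞))).comp hN).inv

lemma measurableSet_open_iterate (k : ℕ) :
    MeasurableSet {x : DartRooted | x.map.emark (x.map.walk^[k] x.dart) = true} :=
  (isLocalOp_walk.iterate k).measurable measurableSet_open

lemma measurable_openCount : Measurable fun x : DartRooted => x.map.openCount x.dart :=
  measurable_sum_range isLocalOp_walk.measurable_minimalPeriod fun k =>
    Measurable.ite (measurableSet_open_iterate k) measurable_const measurable_const

lemma measurable_openFaceInv : Measurable fun x : DartRooted => x.map.openFaceInv x.dart :=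
  Measurable.ite (isLocalOp_walk.measurable_minimalPeriod (measurableSet_singleton 0))
    measurable_const measurable_openCount.inv

lemma measurable_share : Measurable fun x : DartRooted => x.map.share x.dart := by
  classical
  have hclosed : MeasurableSet {x : DartRooted | x.map.emark x.dart ≠ true} :=
    measurableSet_open.compl
  refine Measurable.ite (isLocalOp_walk.measurable_minimalPeriod (measurableSet_singleton 0))
    (Measurable.ite (hclosed.inter ?_) measurable_const measurable_const)
    (Measurable.div (measurable_sum_range isLocalOp_walk.measurable_minimalPeriod fun k =>
      Measurable.ite ((measurableSet_open_iterate k).inter (MeasurableSet.union (.const _)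
        (hclosed.inter ?_))) measurable_const measurable_const) measurable_openCount)
  · change MeasurableSet {x : DartRooted | ∃ k, x.map.walk^[k + 1] (x.map.rev x.dart) = x.dart}
    rw [ofPred_exists]
    exact MeasurableSet.iUnion fun k =>
      ((isLocalOp_walk.iterate (k + 1)).comp isLocalOp_rev).measurableSet_eq isLocalOp_id
  · change MeasurableSet {x : DartRooted | ∀ j < k, x.map.walk^[j] x.dart ≠ x.map.rev x.dart}
    simp only [ofPred_forall]
    exact MeasurableSet.iInter fun j => MeasurableSet.iInter fun _ =>
      ((isLocalOp_walk.iterate j).measurableSet_eq isLocalOp_rev).compl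

end DartRooted

end

section
open Function MarkedMap

namespace MarkedMap

/-! ### Isomorphisms of subgraphs -/

section subIso
variable {X : Type} {M N : MarkedMap X} {H : M.Sub} {K : N.Sub}

/-- An isomorphism of subgraphs on the oriented edges. -/
def Iso.dart (φ : Iso H.toMap K.toMap) : H.darts ≃ K.darts := φ.d

/-- An isomorphism of subgraphs on the vertices. -/
def Iso.vert (φ : Iso H.toMap K.toMap) : H.verts ≃ K.verts := φ.v

lemma Iso.tail_dart (φ : Iso H.toMap K.toMap) (e : H.darts) :
    N.tail (φ.dart e).1 = (φ.vert ⟨M.tail e.1, H.tail_mem e.1 e.2⟩).1 :=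
  congrArg Subtype.val (φ.tail e)

lemma Iso.rev_dart (φ : Iso H.toMap K.toMap) (e : H.darts) :
    N.rev (φ.dart e).1 = (φ.dart ⟨M.rev e.1, H.rev_mem e.1 e.2⟩).1 :=
  congrArg Subtype.val (φ.rev e)

lemma Iso.emark_dart (φ : Iso H.toMap K.toMap) (e : H.darts) :
    N.emark (φ.dart e).1 = M.emark e.1 := φ.emark e

lemma nextIn_of_mem (F : Set M.D) (e : F) (h : M.σ e.1 ∈ F) : (M.nextIn F e).1 = M.σ e.1 := by
  classical
  have : Nat.find (M.exists_return F e) = 0 := (Nat.find_eq_zero _).2 (by simpa using h)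
  simp [nextIn, this]

lemma Iso.σ_dart (φ : Iso H.toMap K.toMap) (e : H.darts) (h : M.σ e.1 ∈ H.darts)
    (h' : N.σ (φ.dart e).1 ∈ K.darts) : N.σ (φ.dart e).1 = (φ.dart ⟨M.σ e.1, h⟩).1 := by
  have h1 := congrArg Subtype.val (φ.σ e)
  have h2 : (M.nextIn H.darts e) = ⟨M.σ e.1, h⟩ := Subtype.ext (nextIn_of_mem _ _ h)
  refine (nextIn_of_mem _ _ h').symm.trans (h1.trans ?_)
  exact congrArg (fun a => (φ.dart a).1) h2

end subIso

/-! ### Isomorphisms of balls -/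

section ballIso
variable {X : Type}

lemma ballVerts_mono (M : MarkedMap X) (v : M.V) {k l : ℕ} (h : k ≤ l) :
    M.ballVerts v k ⊆ M.ballVerts v l := by
  induction l, h using Nat.le_induction with
  | base => exact subset_rfl
  | succ l _ ih => exact ih.trans fun x hx => Or.inl hx

lemma exists_mem_ballVerts (M : MarkedMap X) (u v : M.V) : ∃ R, v ∈ M.ballVerts u R := by
  induction M.connected u v with
  | refl => exact ⟨0, rfl⟩
  | tail _ hbc ih =>
    obtain ⟨R, hR⟩ := ih
    obtain ⟨e, rfl, rfl⟩ := hbc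
    exact ⟨R + 1, Or.inr ⟨e, hR, rfl⟩⟩

lemma mem_ball_darts {M : MarkedMap X} {v : M.V} {k R : ℕ} {e : M.D}
    (h : M.tail e ∈ M.ballVerts v k) (hk : k + 1 ≤ R) : e ∈ (M.ball v R).darts :=
  ⟨M.ballVerts_mono v (by omega) h, M.ballVerts_mono v hk (Or.inr ⟨e, h, rfl⟩)⟩

variable {M N : MarkedMap X} {u : M.V} {u' : N.V} {R : ℕ}
  (φ : Iso (M.ball u R).toMap (N.ball u' R).toMap)
  (hφ : (φ.vert ⟨u, M.mem_ballVerts_self u R⟩).1 = u')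
include hφ

lemma vert_mem_ballVerts {k : ℕ} (hk : k ≤ R) {v : M.V} (hv : v ∈ M.ballVerts u k) :
    (φ.vert ⟨v, M.ballVerts_mono u hk hv⟩).1 ∈ N.ballVerts u' k := by
  induction k generalizing v with
  | zero =>
    obtain rfl : v = u := hv
    exact hφ
  | succ k ih =>
    rcases hv with hv | ⟨e, he, rfl⟩
    · exact Or.inl (ih (by omega) hv)
    · refine Or.inr ⟨(φ.dart ⟨e, mem_ball_darts he hk⟩).1, ?_, ?_⟩
      · rw [φ.tail_dart]
        exact ih (by omega) he
      · rw [φ.rev_dart, φ.tail_dart]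

/-- Near the boundary of a ball the induced rotation skips missing edges. The margin of one ensures
that all edges at the vertex lie in the ball, where the rotation is that of the map. -/
lemma σ_symm_dart {k : ℕ} (hk : k + 1 ≤ R) {e : M.D} (he : M.tail e ∈ M.ballVerts u k)
    (he' : M.tail (M.σ.symm e) ∈ M.ballVerts u k) :
    (φ.dart ⟨M.σ.symm e, mem_ball_darts he' hk⟩).1 =
      N.σ.symm (φ.dart ⟨e, mem_ball_darts he hk⟩).1 := by
  rw [Equiv.eq_symm_apply]
  have h1 : M.σ (M.σ.symm e) ∈ (M.ball u R).darts := by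
    rw [Equiv.apply_symm_apply]; exact mem_ball_darts he hk
  rw [φ.σ_dart _ h1 ?_]
  · congr 2
    exact Subtype.ext (Equiv.apply_symm_apply _ _)
  · refine mem_ball_darts (k := k) ?_ hk
    rw [N.tail_σ, φ.tail_dart]
    exact vert_mem_ballVerts φ hφ (by omega) he'

lemma root_of_symm : (φ.symm.vert ⟨u', N.mem_ballVerts_self u' R⟩).1 = u := by
  have : φ.vert ⟨u, M.mem_ballVerts_self u R⟩ = ⟨u', N.mem_ballVerts_self u' R⟩ :=
    Subtype.ext hφ
  rw [← this]
  exact congrArg Subtype.val (φ.v.symm_apply_apply _)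

end ballIso

/-! ### Words of moves under isomorphisms of balls and of maps. -/

section codeBall
variable {M N : MarkedMap Bool}

lemma tail_σ_symm {X : Type} (M : MarkedMap X) (e : M.D) : M.tail (M.σ.symm e) = M.tail e := by
  rw [← M.tail_σ, Equiv.apply_symm_apply]

variable {u : M.V} {u' : N.V} {R : ℕ}
  (φ : Iso (M.ball u R).toMap (N.ball u' R).toMap)
  (hφ : (φ.vert ⟨u, M.mem_ballVerts_self u R⟩).1 = u')

lemma tail_step_mem (b : Bool) {k : ℕ} {e : M.D} (he : M.tail e ∈ M.ballVerts u k) :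
    M.tail (M.step b e) ∈ M.ballVerts u (k + 1) := by
  cases b with
  | false =>
    refine Or.inl ?_
    rw [step, tail_σ_symm]
    exact he
  | true => exact Or.inr ⟨e, he, rfl⟩

lemma tail_act_mem (w : List Bool) {k : ℕ} {e : M.D} (he : M.tail e ∈ M.ballVerts u k) :
    M.tail (M.act w e) ∈ M.ballVerts u (k + w.length) := by
  induction w generalizing e k with
  | nil => exact he
  | cons b w ih =>
    rw [List.length_cons, show k + (w.length + 1) = k + 1 + w.length by omega]
    exact ih (tail_step_mem b he)

include hφ

lemma step_dart (b : Bool) {k : ℕ} (hk : k + 2 ≤ R) {e : M.D}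
    (he : M.tail e ∈ M.ballVerts u k) :
    (φ.dart ⟨M.step b e, mem_ball_darts (tail_step_mem b he) hk⟩).1 =
      N.step b (φ.dart ⟨e, mem_ball_darts he (by omega)⟩).1 := by
  cases b with
  | false => exact σ_symm_dart φ hφ (by omega) he (by rw [tail_σ_symm]; exact he)
  | true => exact (φ.rev_dart ⟨e, mem_ball_darts he (by omega)⟩).symm

lemma act_dart (w : List Bool) {k : ℕ} (hk : k + w.length + 1 ≤ R) {e : M.D}
    (he : M.tail e ∈ M.ballVerts u k) :
    (φ.dart ⟨M.act w e, mem_ball_darts (tail_act_mem w he) hk⟩).1 =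
      N.act w (φ.dart ⟨e, mem_ball_darts he (by omega)⟩).1 := by
  induction w generalizing e k with
  | nil => rfl
  | cons b w ih =>
    rw [List.length_cons] at hk
    have := ih (k := k + 1) (by omega) (tail_step_mem b he)
    rw [step_dart φ hφ b (by omega) he] at this
    exact this

lemma codeAgree_dart {n : ℕ} (hn : n + 1 ≤ R) {e : M.D} (he : M.tail e = u) :
    DartRooted.CodeAgree n ⟨M, e⟩
      ⟨N, (φ.dart ⟨e, mem_ball_darts (k := 0) (R := R) he (by omega)⟩).1⟩ := by
  intro w w' hw hw'
  have he0 : M.tail e ∈ M.ballVerts u 0 := he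
  have h1 := act_dart φ hφ w (k := 0) (by omega) he0
  have h2 := act_dart φ hφ w' (k := 0) (by omega) he0
  constructor
  · simp only [← h1, ← h2]
    rw [Subtype.val_inj, φ.dart.injective.eq_iff, Subtype.mk.injEq]
  · simp only [← h1]
    rw [φ.emark_dart]

/-- The oriented edges at the roots of isomorphic balls correspond to each other. -/
lemma exists_star_equiv {n : ℕ} (hn : n + 1 ≤ R) :
    ∃ ψ : {e // M.tail e = u} ≃ {e // N.tail e = u'},
      (∀ e, DartRooted.CodeAgree n ⟨M, e.1⟩ ⟨N, (ψ e).1⟩) ∧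
      ∀ e v (hv : v ∈ M.ballVerts u R), M.tail (M.rev e.1) = v ↔
        N.tail (N.rev (ψ e).1) = (φ.vert ⟨v, hv⟩).1 := by
  have hR : 0 + 1 ≤ R := by omega
  have hφ' := root_of_symm φ hφ
  refine ⟨⟨fun e => ⟨(φ.dart ⟨e.1, mem_ball_darts (k := 0) e.2 hR⟩).1, ?_⟩,
    fun e => ⟨(φ.symm.dart ⟨e.1, mem_ball_darts (k := 0) e.2 hR⟩).1, ?_⟩, ?_, ?_⟩,
    fun e => codeAgree_dart φ hφ hn e.2, fun e v hv => ?_⟩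
  · rw [φ.tail_dart]
    exact vert_mem_ballVerts φ hφ (k := 0) (by omega) e.2
  · rw [φ.symm.tail_dart]
    exact vert_mem_ballVerts φ.symm hφ' (k := 0) (by omega) e.2
  · intro e
    have h : (φ.dart.symm (φ.dart ⟨e.1, mem_ball_darts (k := 0) e.2 hR⟩)).1 = e.1 := by rw [Equiv.symm_apply_apply]
    exact Subtype.ext h
  · intro e
    have h : (φ.dart (φ.dart.symm ⟨e.1, mem_ball_darts (k := 0) e.2 hR⟩)).1 = e.1 := by rw [Equiv.apply_symm_apply]
    exact Subtype.ext h
  · simp only [Equiv.coe_fn_mk]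
    rw [φ.rev_dart, φ.tail_dart, Subtype.val_inj, φ.vert.injective.eq_iff]
    exact ⟨fun h => Subtype.ext h, fun h => congrArg Subtype.val h⟩

end codeBall

/-- The oriented edges at the roots of isomorphic maps correspond to each other. -/
lemma Iso.exists_star_equiv {M N : MarkedMap Bool} (φ : Iso M N) {u : M.V} {u' : N.V}
    (hφ : φ.v u = u') (n : ℕ) :
    ∃ ψ : {e // M.tail e = u} ≃ {e // N.tail e = u'},
      (∀ e, DartRooted.CodeAgree n ⟨M, e.1⟩ ⟨N, (ψ e).1⟩) ∧
      ∀ e v, M.tail (M.rev e.1) = v ↔ N.tail (N.rev (ψ e).1) = φ.v v := by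
  have hact : ∀ w e, N.act w (φ.d e) = φ.d (M.act w e) := by
    intro w
    induction w with
    | nil => exact fun e => rfl
    | cons b w ih =>
      intro e
      have : N.step b (φ.d e) = φ.d (M.step b e) := by
        cases b with
        | false => rw [step, step, Equiv.symm_apply_eq, φ.σ, Equiv.apply_symm_apply]
        | true => exact φ.rev e
      rw [act, act, this, ih]
  refine ⟨φ.d.subtypeEquiv fun e => ?_, fun e w w' _ _ => ⟨?_, ?_⟩, fun e v => ?_⟩
  · rw [φ.tail, ← hφ, φ.v.injective.eq_iff]
  · simp only [Equiv.subtypeEquiv_apply, hact, φ.d.injective.eq_iff]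
  · simp only [Equiv.subtypeEquiv_apply, hact, φ.emark]
  · simp only [Equiv.subtypeEquiv_apply, φ.rev, φ.tail, φ.v.injective.eq_iff]

end MarkedMap

end

section
open Function MarkedMap

/-! ### Sums over the oriented edges at the root -/

lemma measurable_of_locally_const {Q : Type*} [TopologicalSpace Q] [MeasurableSpace Q]
    [BorelSpace Q] {F : Q → ℝ≥0∞} (h : ∀ q, ∃ U, IsOpen U ∧ q ∈ U ∧ ∀ q' ∈ U, F q' = F q) :
    Measurable F :=
  ((IsLocallyConstant.iff_exists_open F).2 h).continuous.measurable

lemma exists_measurable_rooted {X : Type} (c : Rooted X → ℝ≥0∞) (h1 : ∀ x y, x ≈ y → c x = c y)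
    (h2 : ∀ x, ∃ R, ∀ y, x.Agree R y → c y = c x) :
    ∃ F : RootedClass X → ℝ≥0∞, Measurable F ∧ ∀ x, F x.cls = c x := by
  refine ⟨Quotient.lift c h1, measurable_of_locally_const fun q => ?_, fun x => rfl⟩
  obtain ⟨x, rfl⟩ := Quotient.exists_rep q
  obtain ⟨R, hR⟩ := h2 x
  refine ⟨_, TopologicalSpace.isOpen_generateFrom_of_mem ⟨x, R, rfl⟩,
    ⟨x, rfl, Iso.refl _, rfl⟩, ?_⟩
  rintro _ ⟨y, rfl, hy⟩
  exact hR y hy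

lemma exists_measurable_doublyRooted {X : Type} (c : DoublyRooted X → ℝ≥0∞)
    (h1 : ∀ x y, x ≈ y → c x = c y)
    (h2 : ∀ x, ∃ R, x.snd ∈ x.map.ballVerts x.fst R ∧ ∀ y, x.Agree R y → c y = c x) :
    ∃ F : DoublyRootedClass X → ℝ≥0∞, Measurable F ∧ ∀ x, F x.cls = c x := by
  refine ⟨Quotient.lift c h1, measurable_of_locally_const fun q => ?_, fun x => rfl⟩
  obtain ⟨x, rfl⟩ := Quotient.exists_rep q
  obtain ⟨R, hx, hR⟩ := h2 x
  -- The basic open set of radius R contains x itself only because the second root lies in the ball.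
  refine ⟨_, TopologicalSpace.isOpen_generateFrom_of_mem ⟨x, R, rfl⟩,
    ⟨x, rfl, Iso.refl _, rfl, hx, rfl⟩, ?_⟩
  rintro _ ⟨y, rfl, hy⟩
  exact hR y hy

/-- To see that a finite sum of a measurable function over oriented edges is measurable, it is
enough to consider indicator functions of local sets. -/
lemma exists_measurable_sum {Y Q : Type*} [MeasurableSpace Q] (cls : Y → Q) {ι : Y → Type*}
    (S : ∀ y, Finset (ι y)) (d : ∀ y, ι y → DartRooted)
    (h : ∀ n A, DartRooted.IsLocal n A → ∃ F : Q → ℝ≥0∞, Measurable F ∧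
      ∀ y, F (cls y) = ∑ i ∈ S y, A.indicator 1 (d y i))
    {φ : DartRooted → ℝ≥0∞} (hφ : Measurable φ) :
    ∃ F : Q → ℝ≥0∞, Measurable F ∧ ∀ y, F (cls y) = ∑ i ∈ S y, φ (d y i) := by
  have hset : ∀ A : Set DartRooted, MeasurableSet A → ∃ F : Q → ℝ≥0∞, Measurable F ∧
      ∀ y, F (cls y) = ∑ i ∈ S y, A.indicator 1 (d y i) := by
    intro A hA
    induction A, hA using MeasurableSpace.induction_on_inter rfl DartRooted.isPiSystem_isLocal with
    | empty => exact ⟨0, measurable_const, fun y => by simp⟩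
    | basic A hA =>
      obtain ⟨n, hA⟩ := hA
      exact h n A hA
    | compl A _ ih =>
      obtain ⟨F, hF, hFA⟩ := ih
      -- The sum over the whole index set is measurable, and complements are obtained by subtraction
      -- from it, which is legitimate because the sums are finite.
      obtain ⟨G, hG, hGA⟩ := h 0 univ fun _ _ _ => Iff.rfl
      refine ⟨fun q => G q - F q, hG.sub hF, fun y => ?_⟩
      have hne : ∑ i ∈ S y, A.indicator (1 : DartRooted → ℝ≥0∞) (d y i) ≠ ∞ :=
        ENNReal.sum_ne_top.2 fun i _ => by
          by_cases hi : d y i ∈ A <;> simp [hi]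
      simp only [hFA, hGA]
      refine ENNReal.sub_eq_of_eq_add hne ?_
      rw [← Finset.sum_add_distrib]
      refine Finset.sum_congr rfl fun i _ => ?_
      by_cases hi : d y i ∈ A <;> simp [hi]
    | iUnion A hd _ ih =>
      choose F hF hFA using ih
      refine ⟨fun q => ∑' n, F n q, Measurable.tsum hF, fun y => ?_⟩
      simp only [hFA]
      rw [Summable.tsum_finsetSum fun _ _ => ENNReal.summable]
      refine Finset.sum_congr rfl fun i _ => ?_
      by_cases hi : d y i ∈ ⋃ n, A n
      · obtain ⟨n, hn⟩ := mem_iUnion.1 hi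
        rw [tsum_eq_single n fun m hm => indicator_of_notMem
          (fun hm' => (hd hm).ne_of_mem hm' hn rfl) _, indicator_of_mem hn, indicator_of_mem hi]
      · rw [indicator_of_notMem hi, ENNReal.tsum_eq_zero]
        exact fun n => indicator_of_notMem (fun hn => hi (mem_iUnion.2 ⟨n, hn⟩)) _
  refine Measurable.ennreal_induction (motive := fun φ => ∃ F : Q → ℝ≥0∞, Measurable F ∧
    ∀ y, F (cls y) = ∑ i ∈ S y, φ (d y i)) ?_ ?_ ?_ hφ
  · intro c A hA
    obtain ⟨F, hF, hFA⟩ := hset A hA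
    refine ⟨fun q => c * F q, hF.const_mul c, fun y => ?_⟩
    simp only [hFA, Finset.mul_sum]
    refine Finset.sum_congr rfl fun i _ => ?_
    by_cases hi : d y i ∈ A <;> simp [hi]
  · rintro f g - - - ⟨F, hF, hFA⟩ ⟨G, hG, hGA⟩
    refine ⟨fun q => F q + G q, hF.add hG, fun y => ?_⟩
    simp only [hFA, hGA, Pi.add_apply, Finset.sum_add_distrib]
  · intro f _ hmono ih
    choose F hF hFA using ih
    refine ⟨fun q => ⨆ n, F n q, Measurable.iSup hF, fun y => ?_⟩
    simp only [hFA]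
    exact (ENNReal.finsetSum_iSup_of_monotone fun i m n hmn => hmono hmn (d y i)).symm

open Classical in
lemma tsum_star {X : Type} (M : MarkedMap X) (v : M.V) (ψ : M.D → ℝ≥0∞) :
    ∑' e : {e // M.tail e = v}, ψ e.1 = ∑' e, if M.tail e = v then ψ e else 0 :=
  (tsum_subtype {e | M.tail e = v} ψ).trans (tsum_congr fun e => by
    by_cases h : M.tail e = v <;> simp [h])

lemma starSum_eq_tsum {X : Type} (M : MarkedMap X) (v : M.V) (ψ : M.D → ℝ≥0∞) :
    M.starSum v ψ = ∑' e : {e // M.tail e = v}, ψ e.1 := by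
  classical
  rw [starSum, tsum_star, tsum_eq_sum (s := (M.finite_star v).toFinset)
    (fun e he => if_neg (by simpa using he))]
  exact Finset.sum_congr rfl fun e he => (if_pos (by simpa using he)).symm

open Classical in
/-- The oriented edges from the first to the second root. -/
def DoublyRooted.darts (x : DoublyRooted Bool) : Finset x.map.D :=
  (x.map.finite_star x.fst).toFinset.filter fun e => x.map.tail (x.map.rev e) = x.snd

open Classical in
lemma DoublyRooted.sum_darts (x : DoublyRooted Bool) (ψ : x.map.D → ℝ≥0∞) :
    ∑ e ∈ x.darts, ψ e = ∑' e : {e // x.map.tail e = x.fst},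
      if x.map.tail (x.map.rev e.1) = x.snd then ψ e.1 else 0 := by
  rw [darts, Finset.sum_filter]
  exact starSum_eq_tsum x.map x.fst fun e => if x.map.tail (x.map.rev e) = x.snd then ψ e else 0

lemma indicator_eq_of_codeAgree {n : ℕ} {A : Set DartRooted} (hA : DartRooted.IsLocal n A)
    {x y : DartRooted} (h : DartRooted.CodeAgree n x y) :
    A.indicator (1 : DartRooted → ℝ≥0∞) x = A.indicator 1 y := by
  have := hA x y h
  by_cases hx : x ∈ A
  · rw [indicator_of_mem hx, indicator_of_mem (this.1 hx)]; rfl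
  · rw [indicator_of_notMem hx, indicator_of_notMem (mt this.2 hx)]

lemma exists_measurable_starSum {φ : DartRooted → ℝ≥0∞} (hφ : Measurable φ) :
    ∃ F : RootedClass Bool → ℝ≥0∞, Measurable F ∧
      ∀ x : Rooted Bool, F x.cls = x.map.starSum x.root fun e => φ ⟨x.map, e⟩ := by
  refine exists_measurable_sum (Y := Rooted Bool) Rooted.cls (ι := fun x => x.map.D)
    (fun x => (x.map.finite_star x.root).toFinset) (fun x e => ⟨x.map, e⟩) (fun n A hA => ?_) hφ
  have key : ∀ x y : Rooted Bool, (∃ ψ : {e // x.map.tail e = x.root} ≃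
      {e // y.map.tail e = y.root}, ∀ e, DartRooted.CodeAgree n ⟨x.map, e.1⟩ ⟨y.map, (ψ e).1⟩) →
      x.map.starSum x.root (fun e => A.indicator 1 ⟨x.map, e⟩) =
        y.map.starSum y.root (fun e => A.indicator 1 ⟨y.map, e⟩) := by
    rintro x y ⟨ψ, hψ⟩
    rw [starSum_eq_tsum, starSum_eq_tsum, ← ψ.tsum_eq]
    exact tsum_congr fun e => indicator_eq_of_codeAgree hA (hψ e)
  refine exists_measurable_rooted (fun x => x.map.starSum x.root
    fun e => A.indicator 1 (⟨x.map, e⟩ : DartRooted)) ?_ fun x => ⟨n + 1, ?_⟩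
  · rintro x y ⟨φ, hφ⟩
    obtain ⟨ψ, hψ, -⟩ := φ.exists_star_equiv hφ n
    exact key x y ⟨ψ, hψ⟩
  · rintro y ⟨φ, hφ⟩
    obtain ⟨ψ, hψ, -⟩ := MarkedMap.exists_star_equiv φ hφ (le_refl (n + 1))
    exact (key x y ⟨ψ, hψ⟩).symm

lemma exists_measurable_sum_darts {φ : DartRooted → ℝ≥0∞} (hφ : Measurable φ) :
    ∃ F : DoublyRootedClass Bool → ℝ≥0∞, Measurable F ∧
      ∀ x : DoublyRooted Bool, F x.cls = ∑ e ∈ x.darts, φ ⟨x.map, e⟩ := by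
  classical
  refine exists_measurable_sum (Y := DoublyRooted Bool) DoublyRooted.cls (ι := fun x => x.map.D)
    (fun x => x.darts) (fun x e => ⟨x.map, e⟩) (fun n A hA => ?_) hφ
  have key : ∀ x y : DoublyRooted Bool, (∃ ψ : {e // x.map.tail e = x.fst} ≃
      {e // y.map.tail e = y.fst},
      (∀ e, DartRooted.CodeAgree n ⟨x.map, e.1⟩ ⟨y.map, (ψ e).1⟩) ∧
      ∀ e, x.map.tail (x.map.rev e.1) = x.snd ↔ y.map.tail (y.map.rev (ψ e).1) = y.snd) →
      ∑ e ∈ x.darts, A.indicator (1 : DartRooted → ℝ≥0∞) ⟨x.map, e⟩ =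
        ∑ e ∈ y.darts, A.indicator (1 : DartRooted → ℝ≥0∞) ⟨y.map, e⟩ := by
    rintro x y ⟨ψ, hψ, hψ'⟩
    rw [DoublyRooted.sum_darts, DoublyRooted.sum_darts, ← ψ.tsum_eq]
    exact tsum_congr fun e => if_congr (hψ' e) (indicator_eq_of_codeAgree hA (hψ e)) rfl
  refine exists_measurable_doublyRooted (fun x => ∑ e ∈ x.darts,
    A.indicator (1 : DartRooted → ℝ≥0∞) ⟨x.map, e⟩) ?_ fun x => ?_
  · rintro x y ⟨φ, hφ, hφ'⟩
    obtain ⟨ψ, hψ, hψ'⟩ := φ.exists_star_equiv hφ n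
    exact key x y ⟨ψ, hψ, fun e => hφ' ▸ hψ' e x.snd⟩
  · obtain ⟨R, hR⟩ := x.map.exists_mem_ballVerts x.fst x.snd
    refine ⟨R + (n + 1), x.map.ballVerts_mono _ (by omega) hR, ?_⟩
    rintro y ⟨φ, hφ, hx, hφ'⟩
    obtain ⟨ψ, hψ, hψ'⟩ := MarkedMap.exists_star_equiv φ hφ (n := n) (by omega)
    exact (key x y ⟨ψ, hψ, fun e => (hψ' e x.snd hx).trans (by rw [← hφ']; rfl)⟩).symm

/-! ### Invariance of unimodular random maps under the moves -/

section invariance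
variable {Ω : Type*} [MeasurableSpace Ω] {P : Measure Ω} {W : Ω → Rooted Bool}

/-- The expected sum of `φ` over the oriented edges at the root. -/
def meanStar (P : Measure Ω) (W : Ω → Rooted Bool) (φ : DartRooted → ℝ≥0∞) : ℝ≥0∞ :=
  ∫⁻ a, (W a).map.starSum (W a).root (fun e => φ ⟨(W a).map, e⟩) ∂P

/-- Rotation permutes the star of the root, so this holds pointwise, without mass transport. -/
lemma meanStar_σ_symm (φ : DartRooted → ℝ≥0∞) :
    meanStar P W (fun x => φ ⟨x.map, x.map.σ.symm x.dart⟩) = meanStar P W φ := by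
  refine lintegral_congr fun a => ?_
  rw [starSum_eq_tsum, starSum_eq_tsum]
  exact ((W a).map.σ.symm.subtypeEquiv (fun e => by rw [tail_σ_symm])).tsum_eq
    fun e : {e // (W a).map.tail e = (W a).root} => φ ⟨(W a).map, e.1⟩

variable (hW : IsUnimodular P W)
include hW

lemma IsUnimodular.measurable_starSum {φ : DartRooted → ℝ≥0∞} (hφ : Measurable φ) :
    Measurable fun a => (W a).map.starSum (W a).root (fun e => φ ⟨(W a).map, e⟩) := by
  obtain ⟨F, hF, hF'⟩ := exists_measurable_starSum hφ
  simp only [← hF']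
  exact hF.comp hW.measurable

/-- Mass transport: a vertex u sends to v the sum of φ over the oriented edges from u to v. The root
sends the sum of φ over its star and receives φ over the reversals of that star. -/
theorem IsUnimodular.meanStar_rev {φ : DartRooted → ℝ≥0∞} (hφ : Measurable φ) :
    meanStar P W (fun x => φ ⟨x.map, x.map.rev x.dart⟩) = meanStar P W φ := by
  classical
  obtain ⟨F, hF, hF'⟩ := exists_measurable_sum_darts hφ
  have h := hW.massTransport F hF
  simp only [hF', DoublyRooted.sum_darts] at h
  refine Eq.trans (lintegral_congr fun a => ?_) (h.symm.trans (lintegral_congr fun a => ?_))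
  · have h1 : ∀ u : (W a).map.V, ∑' e : {e // (W a).map.tail e = u},
        (if (W a).map.tail ((W a).map.rev e.1) = (W a).root then φ ⟨(W a).map, e.1⟩ else 0) = _ :=
      fun u => tsum_star _ u fun e =>
        if (W a).map.tail ((W a).map.rev e) = (W a).root then φ ⟨(W a).map, e⟩ else 0
    simp only [h1]
    rw [ENNReal.tsum_comm]
    have h2 : ∀ e, ∑' u : (W a).map.V, (if (W a).map.tail e = u then
        (if (W a).map.tail ((W a).map.rev e) = (W a).root then φ ⟨(W a).map, e⟩ else 0) else 0) =
        if (W a).map.tail ((W a).map.rev e) = (W a).root then φ ⟨(W a).map, e⟩ else 0 := by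
      intro e
      simp only [eq_comm (a := (W a).map.tail e)]
      exact tsum_ite_eq _ _
    simp only [h2]
    rw [starSum_eq_tsum, ← (W a).map.revPerm.tsum_eq]
    refine (tsum_star _ _ fun e => φ ⟨(W a).map, (W a).map.rev e⟩).trans (tsum_congr fun e => ?_)
    change _ = if (W a).map.tail ((W a).map.rev ((W a).map.rev e)) = (W a).root then
      φ ⟨(W a).map, (W a).map.rev e⟩ else 0
    rw [(W a).map.rev_rev]
  · rw [starSum_eq_tsum, ENNReal.tsum_comm]
    refine tsum_congr fun e => ?_
    simp only [eq_comm (a := (W a).map.tail _)]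
    exact tsum_ite_eq _ _

theorem IsUnimodular.meanStar_dualPerm {φ : DartRooted → ℝ≥0∞} (hφ : Measurable φ) (k : ℕ) :
    meanStar P W (fun x => φ ⟨x.map, x.map.dualPerm^[k] x.dart⟩) = meanStar P W φ := by
  induction k generalizing φ with
  | zero => rfl
  | succ k ih =>
    have h1 : Measurable fun x : DartRooted => φ ⟨x.map, x.map.σ.symm x.dart⟩ :=
      hφ.comp DartRooted.isLocalOp_σ_symm.measurable
    have h2 : Measurable fun x : DartRooted => φ ⟨x.map, x.map.dualPerm x.dart⟩ :=
      hφ.comp DartRooted.isLocalOp_dualPerm.measurable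
    simp only [iterate_succ_apply']
    rw [ih h2, ← meanStar_σ_symm φ, ← hW.meanStar_rev h1]
    rfl

end invariance

end

section
open Function MarkedMap

/-! ### The identity of mean inverse face degrees -/

section mean
variable {Ω : Type*} [MeasurableSpace Ω] {P : Measure Ω} {W : Ω → Rooted Bool}

lemma meanStar_congr {φ ψ : DartRooted → ℝ≥0∞}
    (h : ∀ᵐ a ∂P, ∀ e, φ ⟨(W a).map, e⟩ = ψ ⟨(W a).map, e⟩) :
    meanStar P W φ = meanStar P W ψ :=
  lintegral_congr_ae (h.mono fun a ha => by simp only [ha])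

variable (hW : IsUnimodular P W)
include hW

lemma IsUnimodular.meanStar_add {φ ψ : DartRooted → ℝ≥0∞} (hφ : Measurable φ) :
    meanStar P W (fun x => φ x + ψ x) = meanStar P W φ + meanStar P W ψ := by
  rw [meanStar, meanStar, meanStar, ← lintegral_add_left (hW.measurable_starSum hφ)]
  exact lintegral_congr fun a => Finset.sum_add_distrib

lemma IsUnimodular.meanStar_tsum {φ : ℕ → DartRooted → ℝ≥0∞} (hφ : ∀ k, Measurable (φ k)) :
    meanStar P W (fun x => ∑' k, φ k x) = ∑' k, meanStar P W (φ k) := by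
  simp only [meanStar]
  rw [← lintegral_tsum fun k => (hW.measurable_starSum (hφ k)).aemeasurable]
  exact lintegral_congr fun a => (Summable.tsum_finsetSum fun _ _ => ENNReal.summable).symm

variable (hS : ∀ᵐ a ∂P, ∃ R, (W a).map.HasSides R)
include hS

/-- The share of each oriented edge, spread over the face to its left, is the inverse degree. -/
theorem IsUnimodular.meanStar_share : meanStar P W (fun x => x.map.share x.dart) =
    meanStar P W fun x => x.map.faceInv x.dart := by
  let N : DartRooted → ℕ := fun x => minimalPeriod x.map.dualPerm x.dart
  have hN : Measurable N := DartRooted.isLocalOp_dualPerm.measurable_minimalPeriod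
  -- Each oriented edge distributes its share equally over its face. On an infinite face nothing is
  -- distributed, which loses nothing because the share is 0 there.
  let φ : ℕ → DartRooted → ℝ≥0∞ := fun k x =>
    if k < N x then x.map.share x.dart * x.map.faceInv x.dart else 0
  have hφ : ∀ k, Measurable (φ k) := fun k =>
    Measurable.ite (measurableSet_lt measurable_const hN)
      (DartRooted.measurable_share.mul DartRooted.measurable_faceInv) measurable_const
  have hsum : ∀ (n : ℕ) (f : ℕ → ℝ≥0∞), ∑' k, (if k < n then f k else 0) =
      ∑ k ∈ Finset.range n, f k := fun n f => by
    rw [tsum_eq_sum (s := Finset.range n) (fun k hk => if_neg (by simpa using hk))]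
    exact Finset.sum_congr rfl fun k hk => if_pos (by simpa using hk)
  calc meanStar P W (fun x => x.map.share x.dart)
      = meanStar P W (fun x => ∑' k, φ k x) := meanStar_congr <| by
        filter_upwards [hS] with a ⟨R, hR⟩ e
        simp only [φ, hsum, Finset.sum_const, Finset.card_range, nsmul_eq_mul, N, faceInv]
        by_cases h : minimalPeriod (W a).map.dualPerm e = 0
        · simp [h, hR.share_eq_zero h]
        · rw [if_neg h, mul_left_comm, ENNReal.mul_inv_cancel (by exact_mod_cast h)
            (ENNReal.natCast_ne_top _), mul_one]
    _ = ∑' k, meanStar P W (φ k) := hW.meanStar_tsum hφ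
    _ = ∑' k, meanStar P W (fun x => φ k ⟨x.map, x.map.dualPerm^[k] x.dart⟩) :=
        tsum_congr fun k => (hW.meanStar_dualPerm (hφ k) k).symm
    _ = meanStar P W (fun x => ∑' k, φ k ⟨x.map, x.map.dualPerm^[k] x.dart⟩) :=
        (hW.meanStar_tsum fun k =>
          (hφ k).comp (DartRooted.isLocalOp_dualPerm.iterate k).measurable).symm
    _ = meanStar P W fun x => x.map.faceInv x.dart := meanStar_congr <| by
        filter_upwards [hS] with a ⟨R, hR⟩ e
        have hper : ∀ k, minimalPeriod (W a).map.dualPerm ((W a).map.dualPerm^[k] e) =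
            minimalPeriod (W a).map.dualPerm e := fun k =>
          minimalPeriod_eq_of_sameCycle (sameCycle_iterate _ _ _)
        have hinv : ∀ k, (W a).map.faceInv ((W a).map.dualPerm^[k] e) = (W a).map.faceInv e :=
          fun k => by simp only [faceInv, hper]
        simp only [φ, N, hper, hinv]
        rw [hsum _ fun k => (W a).map.share ((W a).map.dualPerm^[k] e) * (W a).map.faceInv e,
          ← Finset.sum_mul]
        by_cases h : minimalPeriod (W a).map.dualPerm e = 0
        · simp [faceInv, h]
        · rw [hR.sum_share h, one_mul]

/-- The mean inverse face degrees of the map and of the open subgraph differ by half the mean number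
of closed edges. -/
theorem IsUnimodular.two_mul_meanStar_faceInv :
    2 * meanStar P W (fun x => x.map.faceInv x.dart) =
      2 * meanStar P W (fun x =>
        if x.map.emark x.dart = true then x.map.openFaceInv x.dart else 0) +
      meanStar P W (fun x => if x.map.emark x.dart = true then 0 else 1) := by
  let φ : DartRooted → ℝ≥0∞ := fun x =>
    if x.map.emark x.dart = true then x.map.openFaceInv x.dart else 0
  let ψ : DartRooted → ℝ≥0∞ := fun x =>
    if x.map.emark x.dart = true then 0 else x.map.share x.dart
  have hφ : Measurable φ := Measurable.ite DartRooted.measurableSet_open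
    DartRooted.measurable_openFaceInv measurable_const
  have hψ : Measurable ψ := Measurable.ite DartRooted.measurableSet_open measurable_const
    DartRooted.measurable_share
  have h1 : meanStar P W (fun x => x.map.share x.dart) = meanStar P W φ + meanStar P W ψ := by
    rw [← hW.meanStar_add hφ]
    refine meanStar_congr (.of_forall fun a e => ?_)
    by_cases h : (W a).map.emark e = true
    · simp [φ, ψ, h, share_of_open h]
    · simp [φ, ψ, h]
  have h2 : meanStar P W ψ + meanStar P W ψ =
      meanStar P W (fun x => if x.map.emark x.dart = true then 0 else 1) := by
    -- Replacing e by −e in one copy pairs the two shares of each closed edge, which add up to 1.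
    nth_rewrite 2 [← hW.meanStar_rev hψ]
    rw [← hW.meanStar_add hψ]
    refine meanStar_congr ?_
    filter_upwards [hS] with a ⟨R, hR⟩ e
    simp only [ψ, (W a).map.emark_rev]
    split_ifs with h
    · exact add_zero 0
    · exact hR.share_add_share_rev h
  rw [← hW.meanStar_share hS, h1, ← h2, mul_add, two_mul (meanStar P W ψ)]

end mean

/-! ### From mean inverse face degrees to average curvature. -/

lemma cluster_verts_eq_univ {M : MarkedMap Bool} {ρ : M.V} (h1 : M.IsBond)
    (h2 : M.IsConnectedPercolation) : (M.cluster ρ).verts = univ :=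
  eq_univ_of_forall fun v => h2 ρ v (h1 ρ) (h1 v)

lemma integral_curvature_form {Ω : Type*} [MeasurableSpace Ω] {P : Measure Ω}
    [IsProbabilityMeasure P] {f g : Ω → ℝ≥0∞} (hf : Measurable f) (hg : Measurable g)
    (hf' : ∫⁻ a, f a ∂P ≠ ∞) (hg' : ∫⁻ a, g a ∂P ≠ ∞) {κ : Ω → ℝ} (hκ : ∀ᵐ a ∂P, κ a =
      2 * Real.pi - Real.pi * (f a).toReal + 2 * Real.pi * (g a).toReal) :
    Integrable κ P ∧ ∫ a, κ a ∂P =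
      2 * Real.pi - Real.pi * (∫⁻ a, f a ∂P).toReal + 2 * Real.pi * (∫⁻ a, g a ∂P).toReal := by
  have hf1 := (integrable_toReal_of_lintegral_ne_top hf.aemeasurable hf').const_mul Real.pi
  have hg1 := (integrable_toReal_of_lintegral_ne_top hg.aemeasurable hg').const_mul (2 * Real.pi)
  have hc : Integrable (fun _ : Ω => 2 * Real.pi) P := integrable_const _
  have hc' : ∫ _ : Ω, 2 * Real.pi ∂P = 2 * Real.pi := by simp
  have hs : Integrable (fun a => 2 * Real.pi - Real.pi * (f a).toReal) P := hc.sub hf1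
  refine ⟨(hs.add hg1).congr (hκ.mono fun a ha => ha.symm), ?_⟩
  rw [integral_congr_ae hκ, integral_add hs hg1, integral_sub hc hf1, hc', integral_const_mul,
    integral_const_mul, integral_toReal hf.aemeasurable (ae_lt_top hf hf'),
    integral_toReal hg.aemeasurable (ae_lt_top hg hg')]

end

end RandomMap

end

/-- `W a = (M, ρ, ω)`: the rooted map together with the percolation, as a `{0,1}`-marking. -/
theorem mainTheorem11 {Ω : Type*} [MeasurableSpace Ω] (P : Measure Ω) [IsProbabilityMeasure P]
    (W : Ω → RandomMap.Rooted Bool)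
    (hM : RandomMap.IsUnimodular P fun a => (W a).forget)
    (hdeg : ∫⁻ a, ((W a).forget.degree : ℝ≥0∞) ∂P < ∞)
    (hω : RandomMap.IsUnimodular P W)
    (hbond : ∀ᵐ a ∂P, (W a).map.IsBond)
    (hconn : ∀ᵐ a ∂P, (W a).map.IsConnectedPercolation)
    (hsub : ∀ᵐ a ∂P, ((W a).map.cluster (W a).root).IsSubmap) :
    Integrable (fun a => (W a).forget.curvature) P ∧
    Integrable (fun a => (W a).rootCluster.curvature) P ∧
    RandomMap.averageCurvature P (fun a => (W a).rootCluster) =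
      RandomMap.averageCurvature P (fun a => (W a).forget) := by
  have hv : ∀ᵐ a ∂P, ((W a).map.cluster (W a).root).verts = univ := by
    filter_upwards [hbond, hconn] with a h1 h2 using RandomMap.cluster_verts_eq_univ h1 h2
  have hS : ∀ᵐ a ∂P, ∃ R, (W a).map.HasSides R := by
    filter_upwards [hv, hsub] with a h1 h2 using RandomMap.MarkedMap.exists_hasSides h1 h2
  have hopen := RandomMap.DartRooted.measurableSet_open
  have hm0 : Measurable fun _ : RandomMap.DartRooted => (1 : ℝ≥0∞) := measurable_const
  have hm1 := RandomMap.DartRooted.measurable_faceInv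
  have hm2 : Measurable fun x : RandomMap.DartRooted =>
      if x.map.emark x.dart = true then (1 : ℝ≥0∞) else 0 :=
    Measurable.ite hopen measurable_const measurable_const
  have hm3 : Measurable fun x : RandomMap.DartRooted =>
      if x.map.emark x.dart = true then x.map.openFaceInv x.dart else 0 :=
    Measurable.ite hopen RandomMap.DartRooted.measurable_openFaceInv measurable_const
  have hD : RandomMap.meanStar P W (fun _ => 1) ≠ ∞ := by
    simp only [RandomMap.Rooted.degree, RandomMap.Rooted.forget,
      RandomMap.MarkedMap.degree_eq] at hdeg
    exact hdeg.ne
  -- The finite mean degree bounds all the means in use, so the identities between them can be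
  -- passed to the reals and subtracted.
  have hfin : ∀ φ : RandomMap.DartRooted → ℝ≥0∞, (∀ᵐ a ∂P, ∀ e, φ ⟨(W a).map, e⟩ ≤ 1) →
      RandomMap.meanStar P W φ ≠ ∞ := fun φ h =>
    ne_top_of_le_ne_top hD (lintegral_mono_ae (h.mono fun a ha => Finset.sum_le_sum
      fun e _ => ha e))
  have hA := hfin (fun x => x.map.faceInv x.dart)
    (.of_forall fun a e => RandomMap.MarkedMap.faceInv_le_one e)
  have hO := hfin (fun x => if x.map.emark x.dart = true then 1 else 0)
    (.of_forall fun a e => by dsimp only; split_ifs <;> simp)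
  have hC := hfin (fun x => if x.map.emark x.dart = true then 0 else 1)
    (.of_forall fun a e => by dsimp only; split_ifs <;> simp)
  have hB := hfin (fun x => if x.map.emark x.dart = true then x.map.openFaceInv x.dart else 0) (by
    filter_upwards [hS] with a ⟨R, hR⟩ e
    split_ifs
    · exact hR.openFaceInv_le_one e
    · exact zero_le_one)
  obtain ⟨hI1, hE1⟩ := RandomMap.integral_curvature_form (hω.measurable_starSum hm0)
    (hω.measurable_starSum hm1) hD hA (κ := fun a => (W a).forget.curvature)
    (.of_forall fun a => RandomMap.MarkedMap.curvature_eq (W a).root)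
  obtain ⟨hI2, hE2⟩ := RandomMap.integral_curvature_form (hω.measurable_starSum hm2)
    (hω.measurable_starSum hm3) hO hB (κ := fun a => (W a).rootCluster.curvature) (by
      filter_upwards [hv, hsub] with a h1 h2 using RandomMap.MarkedMap.cluster_curvature_eq h1 h2)
  refine ⟨hI1, hI2, hE2.trans (Eq.trans ?_ hE1.symm)⟩
  have h1 : RandomMap.meanStar P W (fun _ => 1) =
      RandomMap.meanStar P W (fun x => if x.map.emark x.dart = true then 1 else 0) +
      RandomMap.meanStar P W (fun x => if x.map.emark x.dart = true then 0 else 1) := by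
    rw [← hω.meanStar_add hm2]
    refine RandomMap.meanStar_congr (.of_forall fun a e => ?_)
    dsimp only
    split_ifs <;> simp
  have h2 := hω.two_mul_meanStar_faceInv hS
  have h1' := congrArg ENNReal.toReal h1
  have h2' := congrArg ENNReal.toReal h2
  rw [ENNReal.toReal_add hO hC] at h1'
  rw [ENNReal.toReal_add (ENNReal.mul_ne_top (by simp) hB) hC, ENNReal.toReal_mul,
    ENNReal.toReal_mul, ENNReal.toReal_ofNat] at h2'
  simp only [RandomMap.meanStar] at h1' h2'
  rw [h1']
  -- With C the mean number of closed oriented edges at the root, the degree term falls by πC when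
  -- the closed edges are restored, and the face term rises by the same amount.
  linear_combination (-Real.pi) * h2'
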